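/- Fix $n,d\ge 1$, functions $f_1,\dots,f_n:\mathbb R^d\to\mathbb R$, and stochastic gradients $g_i^t(x)=\nabla f_i(x)+\xi_i^t$. For parameter sequences $\varphi_t,\epsilon_t,\beta_t,\eta_t$ let $\Psi_t(y)=\varphi_t\,y/\sqrt{y^2+\epsilon_t}$, applied component-wise to vectors. The server-client algorithm SClip-EF starts from $x^0\in\mathbb R^d$, $m_i^0=0$ and iterates $$m_i^{t+1}=\beta_t m_i^t+(1-\beta_t)\Psi_t\big(g_i^t(x^t)-m_i^t\big),\qquad x^{t+1}=x^t-\frac{\eta_t}{n}\sum_{i=1}^n m_i^{t+1}.$$ The algorithm SClip-EF-Network with mixing matrix $W=(w_{ij})$ starts from a common point $x_i^0=x^0$, $m_i^0=0$ and iterates $$m_i^{t+1}=\beta_t m_i^t+(1-\beta_t)\Psi_t\big(g_i^t(x_i^t)-m_i^t\big),\qquad x_i^{t+1}=\sum_{j=1}^n w_{ij}\big(x_j^t-\eta_t m_j^{t+1}\big).$$ (i) If $W=\frac1n\mathbf 1\mathbf 1^\top$, then, for arbitrary parameter sequences and stochastic gradients, $x_i^t$ and $m_i^t$ of SClip-EF-Network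 coincide with $x^t$ and $m_i^t$ of SClip-EF for all $i$ and $t$. (ii) Let $0<\mu\le L$, $\kappa=L/\mu$, $\sigma>0$, and assume the following. 1. Every $f_i$ is twice continuously differentiable with $\mu I\preceq\nabla^2 f_i(x)\preceq L I$ for all $x$. 2. $x^*$ is the minimizer of $f=\frac1n\sum_i f_i$, and $\|\nabla f_i(x^*)\|_\infty\le c_*$ for all $i$. 3. The families $(\xi_i^t)_{i}$, $t\ge0$, of random vectors in $\mathbb R^d$ are independent over $t$, and every component of every $\xi_i^t$ has the same probability density $p$ on $\mathbb R$, with $p(u)=p(-u)$ for all $u$ and $\int|u|\,p(u)\,du\le\sigma$. Run SClip-EF with $$\varphi_t=\frac{c_\varphi}{\sqrt{t+1}},\quad \epsilon_t=\tau(t+1)^{3/5},\quad \beta_t=\frac{c_\beta}{\sqrt{t+1}},\quad \eta_t=\frac{c_\eta}{(t+1)^{1/5}},$$ where $c_\varphi,c_\eta>0$, $0\le c_\beta<1$, $c_\eta^2c_\varphi^2=\Theta(\sigma^2/\mu^2)$ and $\tau=\Theta(d\sigma^2\kappa^{5/2})$, that is, $$a_1\frac{\sigma^2}{\mu^2}\le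 c_\eta^2c_\varphi^2\le a_2\frac{\sigma^2}{\mu^2},\qquad b_1d\sigma^2\kappa^{5/2}\le\tau\le b_2d\sigma^2\kappa^{5/2}$$ with constants $0<a_1\le a_2$ and $0<b_1\le b_2$, these choices being compatible in the sense that $$\tau\ \ge\ 98\sqrt{2(\kappa-1)}\;c_\eta^2c_\varphi^2\,d\,L^2$$ (which is automatic if $b_1\ge 98\sqrt2\,a_2$). Then there is a constant $c_s\ge c_0\,d^{-1/2}\kappa^{-5/4}$, where $c_0>0$ depends only on $a_1,a_2,b_1,b_2$, and $c_s$ depends only on these and on $d,\mu,L,\sigma,c_\varphi,\tau,c_\beta,c_\eta$, such that for every $x^0$ and every $0<\delta<\min(c_s,2/5)$ all the expectations $\mathbb E\|x^t-x^*\|^2$ are finite and $$\lim_{t\to\infty}(t+1)^\delta\,\mathbb E\|x^t-x^*\|^2=0.$$ -/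

import Mathlib

open MeasureTheory ProbabilityTheory Filter Topology

noncomputable section

/-- The Euclidean space `ℝ^d`. -/
abbrev Vec (d : ℕ) : Type := EuclideanSpace ℝ (Fin d)

/-- The component-wise smooth clipping operator: each component `y` is sent to
`y φ / √(y² + ε)`. -/
def smoothClip {d : ℕ} (φ ε : ℝ) (y : Vec d) : Vec d :=
  WithLp.toLp 2 fun k => y k * φ / √((y k) ^ 2 + ε)

/-- The parameter sequences of the algorithms: clipping parameters `φ t`, `ε t`, error feedback
weights `β t`, and step sizes `η t`. -/
structure ClipParams where
  φ : ℕ → ℝ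
  ε : ℕ → ℝ
  β : ℕ → ℝ
  η : ℕ → ℝ

/-- The weighted error feedback update of one local gradient estimator `m`, given the stochastic
gradient `g` observed at iteration `t`: `β_t m + (1 - β_t) Ψ_t (g - m)`. -/
def feedback {d : ℕ} (θ : ClipParams) (t : ℕ) (m g : Vec d) : Vec d :=
  θ.β t • m + (1 - θ.β t) • smoothClip (θ.φ t) (θ.ε t) (g - m)

/-- The server-client algorithm SClip-EF. The oracle `g t i` returns the stochastic gradient of
node `i` at iteration `t` for a given query. The state after `t` iterations is the pair of the
server iterate `x^t` and the family of the local estimators `m_i^t`. -/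
def sclipEF {n d : ℕ} (θ : ClipParams) (g : ℕ → Fin n → Vec d → Vec d) (x₀ : Vec d) :
    ℕ → Vec d × (Fin n → Vec d)
  | 0 => (x₀, fun _ => 0)
  | t + 1 =>
    let x := (sclipEF θ g x₀ t).1
    let m := (sclipEF θ g x₀ t).2
    let m' : Fin n → Vec d := fun i => feedback θ t (m i) (g t i x)
    (x - (θ.η t / (n : ℝ)) • ∑ i, m' i, m')

/-- The decentralized algorithm SClip-EF-Network with mixing matrix `W`. The state after `t`
iterations is the pair of the families of the local iterates `x_i^t` and of the local estimators
`m_i^t`. -/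
def sclipEFNetwork {n d : ℕ} (W : Matrix (Fin n) (Fin n) ℝ) (θ : ClipParams)
    (g : ℕ → Fin n → Vec d → Vec d) (x₀ : Fin n → Vec d) :
    ℕ → (Fin n → Vec d) × (Fin n → Vec d)
  | 0 => (x₀, fun _ => 0)
  | t + 1 =>
    let x := (sclipEFNetwork W θ g x₀ t).1
    let m := (sclipEFNetwork W θ g x₀ t).2
    let m' : Fin n → Vec d := fun i => feedback θ t (m i) (g t i (x i))
    (fun i => ∑ j, W i j • (x j - θ.η t • m' j), m')

/-- The matrix `(1/n) 𝟏 𝟏ᵀ`. -/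
def averagingMatrix (n : ℕ) : Matrix (Fin n) (Fin n) ℝ :=
  (1 / (n : ℝ)) • Matrix.vecMulVec 1 1

/-- The parameter schedule
`φ_t = c_φ / √(t+1)`, `ε_t = τ (t+1)^(3/5)`, `β_t = c_β / √(t+1)`, `η_t = c_η / (t+1)^(1/5)`. -/
def schedule (cφ τ cβ cη : ℝ) : ClipParams where
  φ t := cφ / √((t : ℝ) + 1)
  ε t := τ * ((t : ℝ) + 1) ^ (3 / 5 : ℝ)
  β t := cβ / √((t : ℝ) + 1)
  η t := cη / ((t : ℝ) + 1) ^ (1 / 5 : ℝ)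

/-- `f` is twice continuously differentiable and its Hessian satisfies
`μ I ⪯ ∇² f(x) ⪯ L I` at every point. -/
structure HessianBounds {d : ℕ} (μ L : ℝ) (f : Vec d → ℝ) : Prop where
  contDiff : ContDiff ℝ 2 f
  lower : ∀ x v : Vec d, μ * ‖v‖ ^ 2 ≤ fderiv ℝ (fderiv ℝ f) x v v
  upper : ∀ x v : Vec d, fderiv ℝ (fderiv ℝ f) x v v ≤ L * ‖v‖ ^ 2

/-- `p` is a probability density on `ℝ` that is symmetric about zero and whose first absolute
moment is at most `σ`. (That it integrates to one follows from its being the density of a random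
variable.) -/
structure SymmetricDensity (σ : ℝ) (p : ℝ → ℝ) : Prop where
  measurable : Measurable p
  nonneg : ∀ u, 0 ≤ p u
  symm : ∀ u, p u = p (-u)
  integrable : Integrable fun u => |u| * p u
  moment : ∫ u, |u| * p u ≤ σ

/-- The gradient noise: `ξ t ω i` is the noise vector of node `i` at iteration `t`. The noise is
independent over the iterations (no independence over nodes or components), and every component
of every noise vector has the marginal density `p`. -/
structure GradientNoise {Ω : Type*} [MeasurableSpace Ω] (P : Measure Ω) {n d : ℕ} (p : ℝ → ℝ)
    (ξ : ℕ → Ω → Fin n → Vec d) : Prop where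
  measurable : ∀ t, Measurable (ξ t)
  indep : iIndepFun ξ P
  density : ∀ t i k,
    P.map (fun ω => ξ t ω i k) = volume.withDensity fun u => ENNReal.ofReal (p u)

/-- The stochastic gradient oracle `g_i(x) = ∇ f_i(x) + ξ_i^t` along the noise path `ω`. -/
def noisyGradient {Ω : Type*} {n d : ℕ} (f : Fin n → Vec d → ℝ) (ξ : ℕ → Ω → Fin n → Vec d)
    (ω : Ω) (t : ℕ) (i : Fin n) (x : Vec d) : Vec d :=
  gradient (f i) x + ξ t ω i

end

/-!
Why the theorem is true. With `v = x^t - x*` and `T = t + 1`, the clipped estimators have components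
of size at most about `cφ T^(-1/2)`, so the iterates move by at most `√d cη cφ T^(-7/10)` per step
(up to a summable correction) and `‖v‖` grows at most like `(10/3) √d cη cφ T^(3/10)`
(`ScheduleConstants.exists_norm_sub_le`). The gradients therefore stay within a fixed multiple of
`√ε_t = √τ T^(3/10)`, and clipping acts on each component of a gradient as multiplication by a factor
in `[1 / √(1 + ρ), 1]`, where `ρ` is about `(100/9) d L² cη² cφ² / τ`.

A componentwise rescaling of `∇f_i(x) - ∇f_i(x*)` remains a descent direction although its factors
are not equal: the angle between `v` and the gradient difference is controlled by cocoercivity and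
Kantorovich's inequality, and the compatibility of `τ` with `√(κ - 1)` keeps the distortion below
what that angle allows (`HessianBounds.le_sum_shrunk_gradient`). The remaining errors are of lower
order. The gradients at `x*` sum to zero and are shrunk only by a relative amount
`O((1 + ‖v‖) T^(-3/10))`; symmetric noise biases the clipped value of `a` only by a multiple of
`|a| / √ε_t`, by a second difference estimate (`abs_integral_unitClip_add_sub_le`); and the error
feedback contributes `O(‖v‖ T^(-6/5))` to the drift.

Since the state at time `t` is independent of the noise at time `t`, the conditional mean of the
drift can be computed by Fubini (`GradientNoise.integral_inner_eq_integral_meanDrift`), and the step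
size in the linear regime is `η_t φ_t / √ε_t = (cη cφ / √τ) / T`. This gives, eventually,
`e_{t+1} ≤ (1 - c / T) e_t + C T^(-7/5)` for `e_t = E ‖x^t - x*‖²`, with `c` as in
`contractionRate`, and the claim follows from a lemma of Chung's type
(`tendsto_rpow_mul_of_recursion`).
-/

/-! ### Averaging as a mixing matrix -/

theorem sclipEFNetwork_averagingMatrix {n d : ℕ} (θ : ClipParams) (g : ℕ → Fin n → Vec d → Vec d)
    (x₀ : Vec d) (t : ℕ) (i : Fin n) :
    (sclipEFNetwork (averagingMatrix n) θ g (fun _ => x₀) t).1 i = (sclipEF θ g x₀ t).1 ∧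
      (sclipEFNetwork (averagingMatrix n) θ g (fun _ => x₀) t).2 i = (sclipEF θ g x₀ t).2 i := by
  induction t generalizing i with
  | zero => exact ⟨rfl, rfl⟩
  | succ t ih =>
    have hn : (n : ℝ) ≠ 0 := by
      have := i.pos
      positivity
    have hm : ∀ j, (sclipEFNetwork (averagingMatrix n) θ g (fun _ => x₀) (t + 1)).2 j
        = (sclipEF θ g x₀ (t + 1)).2 j := fun j => by
      simp only [sclipEFNetwork, sclipEF, (ih j).1, (ih j).2]
    refine ⟨?_, hm i⟩
    have h1 : (sclipEFNetwork (averagingMatrix n) θ g (fun _ => x₀) (t + 1)).1 i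
        = ∑ j, (1 / (n : ℝ)) • ((sclipEF θ g x₀ t).1 - θ.η t • (sclipEF θ g x₀ (t + 1)).2 j) := by
      simp only [sclipEFNetwork, sclipEF, (ih _).1, (ih _).2]
      simp [averagingMatrix, Matrix.vecMulVec]
    rw [h1, ← Finset.smul_sum, Finset.sum_sub_distrib, ← Finset.smul_sum]
    simp only [Finset.sum_const, Finset.card_univ, Fintype.card_fin, smul_sub, sclipEF]
    rw [← Nat.cast_smul_eq_nsmul ℝ, smul_smul, smul_smul, one_div_mul_cancel hn, one_smul,
      one_div_mul_eq_div]

/-! ### Scalar smooth clipping -/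

/-- Scalar smooth clipping with unit height, `y / √(y² + ε)`. -/
noncomputable def unitClip (ε y : ℝ) : ℝ := y / √(y ^ 2 + ε)

/-- The factor by which `√ε * unitClip ε` shrinks its argument. -/
noncomputable def shrinkage (ε y : ℝ) : ℝ := √ε / √(y ^ 2 + ε)

theorem smoothClip_apply {d : ℕ} (φ ε : ℝ) (y : Vec d) (k : Fin d) :
    smoothClip φ ε y k = φ * unitClip ε (y k) := by
  simp only [smoothClip, unitClip]
  ring

theorem continuous_unitClip {ε : ℝ} (hε : 0 < ε) : Continuous (unitClip ε) := by
  unfold unitClip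
  exact continuous_id.div (by fun_prop) fun y => by positivity

theorem abs_unitClip_le_one {ε : ℝ} (hε : 0 ≤ ε) (y : ℝ) : |unitClip ε y| ≤ 1 := by
  rw [unitClip, abs_div, abs_of_nonneg (Real.sqrt_nonneg _)]
  refine div_le_one_of_le₀ (Real.abs_le_sqrt ?_) (Real.sqrt_nonneg _)
  linarith

theorem sqrt_mul_unitClip (ε y : ℝ) : √ε * unitClip ε y = shrinkage ε y * y := by
  simp only [unitClip, shrinkage]
  ring

theorem shrinkage_le_one (ε y : ℝ) : shrinkage ε y ≤ 1 :=
  div_le_one_of_le₀ (Real.sqrt_le_sqrt (by nlinarith)) (Real.sqrt_nonneg _)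

theorem one_sub_shrinkage_le {ε : ℝ} (hε : 0 < ε) (y : ℝ) :
    1 - shrinkage ε y ≤ |y| / √ε := by
  have h1 : 0 < √ε := Real.sqrt_pos.2 hε
  have h2 : √(y ^ 2 + ε) ≤ |y| + √ε := by
    rw [Real.sqrt_le_left (by positivity)]
    nlinarith [sq_abs y, Real.sq_sqrt hε.le, abs_nonneg y]
  have h3 : √ε ≤ √(y ^ 2 + ε) := Real.sqrt_le_sqrt (by nlinarith)
  have h4 : 0 < √(y ^ 2 + ε) := h1.trans_le h3
  rw [shrinkage, one_sub_div h4.ne', div_le_div_iff₀ h4 h1]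
  nlinarith [abs_nonneg y]

theorem le_shrinkage {ε ρ y : ℝ} (hε : 0 < ε) (hρ : 0 ≤ ρ) (hy : y ^ 2 ≤ ρ * ε) :
    1 / √(1 + ρ) ≤ shrinkage ε y := by
  rw [shrinkage, div_le_div_iff₀ (by positivity) (by positivity), one_mul,
    ← Real.sqrt_mul hε.le]
  exact Real.sqrt_le_sqrt (by nlinarith)

/-- The derivative of `unitClip ε`. -/
noncomputable def unitClipDeriv (ε y : ℝ) : ℝ := ε / ((y ^ 2 + ε) * √(y ^ 2 + ε))

theorem hasDerivAt_unitClip {ε : ℝ} (hε : 0 < ε) (y : ℝ) :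
    HasDerivAt (unitClip ε) (unitClipDeriv ε y) y := by
  have hpos : 0 < y ^ 2 + ε := by positivity
  have h1 : HasDerivAt (fun y : ℝ => y ^ 2 + ε) (2 * y) y := by
    simpa using (hasDerivAt_pow 2 y).add_const ε
  have h2 := (hasDerivAt_id y).div (h1.sqrt hpos.ne') (Real.sqrt_pos.2 hpos).ne'
  refine h2.congr_deriv (Eq.symm ?_)
  have hs := Real.sq_sqrt hpos.le
  have hs0 := Real.sqrt_pos.2 hpos
  rw [unitClipDeriv, hs, div_eq_div_iff (by positivity) hpos.ne']
  simp only [id]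
  set r := √(y ^ 2 + ε)
  have hε' : ε = r ^ 2 - y ^ 2 := by linarith
  field_simp
  rw [hε']

theorem abs_unitClipDeriv_sub_le {ε : ℝ} (hε : 0 < ε) (a b : ℝ) :
    |unitClipDeriv ε a - unitClipDeriv ε b| ≤ 3 / ε * |a - b| := by
  have hd : ∀ y, HasDerivAt (unitClipDeriv ε)
      (-3 * ε * y / ((y ^ 2 + ε) ^ 2 * √(y ^ 2 + ε))) y := fun y => by
    have hpos : 0 < y ^ 2 + ε := by positivity
    have h1 : HasDerivAt (fun y : ℝ => y ^ 2 + ε) (2 * y) y := by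
      simpa using (hasDerivAt_pow 2 y).add_const ε
    have hs0 := Real.sqrt_pos.2 hpos
    have h2 := (hasDerivAt_const y ε).div (h1.mul (h1.sqrt hpos.ne')) (mul_pos hpos hs0).ne'
    refine h2.congr_deriv (Eq.symm ?_)
    have hs := Real.sq_sqrt hpos.le
    simp only [Pi.mul_apply]
    set r := √(y ^ 2 + ε)
    rw [← hs]
    field_simp
    ring
  have := Convex.norm_image_sub_le_of_norm_hasDerivWithin_le (C := 3 / ε) (s := Set.univ)
    (fun x _ => (hd x).hasDerivWithinAt) (fun y _ => ?_) convex_univ (Set.mem_univ b)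
    (Set.mem_univ a)
  · simpa [Real.norm_eq_abs] using this
  have hpos : 0 < y ^ 2 + ε := by positivity
  have hs0 := Real.sqrt_pos.2 hpos
  have hy : |y| ≤ √(y ^ 2 + ε) := Real.abs_le_sqrt (by linarith)
  rw [Real.norm_eq_abs, abs_div, abs_mul,
    abs_of_pos (show 0 < (y ^ 2 + ε) ^ 2 * √(y ^ 2 + ε) by positivity),
    div_le_div_iff₀ (by positivity) hε, abs_mul, abs_of_pos hε]
  norm_num
  have h5 : ε ^ 2 ≤ (y ^ 2 + ε) ^ 2 := by nlinarith [sq_nonneg y]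
  nlinarith [mul_le_mul hy h5 (by positivity) hs0.le]

/-- The second difference of `unitClip` gains a factor of the argument `a`, because it is odd in
`a`; this is what makes the bias caused by symmetric noise proportional to the signal. -/
theorem abs_unitClip_second_difference_le {ε : ℝ} (hε : 0 < ε) (a u : ℝ) :
    |unitClip ε (a + u) + unitClip ε (a - u) - 2 * unitClip ε a| ≤ 6 / ε * |u| * |a| := by
  have hd : ∀ y, HasDerivAt
      (fun y => unitClip ε (y + u) + unitClip ε (y - u) - 2 * unitClip ε y)
      (unitClipDeriv ε (y + u) + unitClipDeriv ε (y - u) - 2 * unitClipDeriv ε y) y := fun y => by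
    have h1 := (hasDerivAt_unitClip hε (y + u)).comp_add_const y u
    have h2 := (hasDerivAt_unitClip hε (y - u)).comp_sub_const y u
    exact (h1.add h2).sub ((hasDerivAt_unitClip hε y).const_mul 2)
  have := Convex.norm_image_sub_le_of_norm_hasDerivWithin_le (C := 6 / ε * |u|) (s := Set.univ)
    (fun x _ => (hd x).hasDerivWithinAt) (fun y _ => ?_) convex_univ (Set.mem_univ 0)
    (Set.mem_univ a)
  · have h0 : unitClip ε (0 + u) + unitClip ε (0 - u) - 2 * unitClip ε 0 = 0 := by
      simp [unitClip, neg_div]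
    rw [h0] at this
    simpa [Real.norm_eq_abs] using this
  have h1 := abs_unitClipDeriv_sub_le hε (y + u) y
  have h2 := abs_unitClipDeriv_sub_le hε (y - u) y
  rw [add_sub_cancel_left] at h1
  rw [show y - u - y = -u by ring, abs_neg] at h2
  calc _ = |(unitClipDeriv ε (y + u) - unitClipDeriv ε y)
          + (unitClipDeriv ε (y - u) - unitClipDeriv ε y)| := by
        rw [Real.norm_eq_abs]; congr 1; ring
    _ ≤ _ := (abs_add_le _ _).trans ((add_le_add h1 h2).trans (le_of_eq (by ring)))

/-! ### Clipping under symmetric noise -/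

/-- The law `ν` on `ℝ` is symmetric about zero, with first absolute moment at most `σ`. Symmetry is
stated for integrals, which is the form in which it is used. -/
structure IsSymmetricNoise (σ : ℝ) (ν : Measure ℝ) : Prop where
  symm : ∀ F : ℝ → ℝ, ∫ u, F (-u) ∂ν = ∫ u, F u ∂ν
  integrable_abs : Integrable (fun u => |u|) ν
  integral_abs_le : ∫ u, |u| ∂ν ≤ σ

theorem SymmetricDensity.isSymmetricNoise {σ : ℝ} {p : ℝ → ℝ} (hp : SymmetricDensity σ p) :
    IsSymmetricNoise σ (volume.withDensity fun u => ENNReal.ofReal (p u)) := by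
  have hm : Measurable fun u => ENNReal.ofReal (p u) := hp.measurable.ennreal_ofReal
  have hfin : ∀ᵐ u ∂(volume : Measure ℝ), ENNReal.ofReal (p u) < ⊤ :=
    ae_of_all _ fun u => ENNReal.ofReal_lt_top
  have hint : ∀ F : ℝ → ℝ, ∫ u, F u ∂(volume.withDensity fun u => ENNReal.ofReal (p u))
      = ∫ u, F u * p u := fun F => by
    rw [integral_withDensity_eq_integral_toReal_smul hm hfin]
    refine integral_congr_ae (ae_of_all _ fun u => ?_)
    simp [ENNReal.toReal_ofReal (hp.nonneg u), mul_comm]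
  refine ⟨fun F => ?_, ?_, ?_⟩
  · rw [hint, hint, ← integral_neg_eq_self fun u => F u * p u]
    exact integral_congr_ae (ae_of_all _ fun u => by simp only [hp.symm u])
  · rw [integrable_withDensity_iff hm hfin]
    refine hp.integrable.congr (ae_of_all _ fun u => ?_)
    simp [ENNReal.toReal_ofReal (hp.nonneg u)]
  · rw [hint]
    exact hp.moment

/-- Symmetric noise perturbs the mean of the clipped value `a` only by a multiple of `|a|`. -/
theorem abs_integral_unitClip_add_sub_le {σ : ℝ} {ν : Measure ℝ} [IsProbabilityMeasure ν]
    (hν : IsSymmetricNoise σ ν) {ε : ℝ} (hε : 0 < ε) (a : ℝ) :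
    |√ε * ∫ u, unitClip ε (a + u) ∂ν - shrinkage ε a * a| ≤ 3 * σ * |a| / √ε := by
  have hbd : ∀ c : ℝ → ℝ, Measurable c → Integrable (fun u => unitClip ε (c u)) ν := fun c hc =>
    Integrable.of_bound ((continuous_unitClip hε).measurable.comp hc).aestronglyMeasurable 1
      (ae_of_all _ fun u => abs_unitClip_le_one hε.le _)
  have h1 : ∫ u, unitClip ε (a - u) ∂ν = ∫ u, unitClip ε (a + u) ∂ν := by
    rw [← hν.symm fun u => unitClip ε (a + u)]
    simp only [sub_eq_add_neg]
  have i1 := hbd (fun u => a + u) (by fun_prop)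
  have i2 := hbd (fun u => a - u) (by fun_prop)
  have h2 : ∫ u, (unitClip ε (a + u) + unitClip ε (a - u) - 2 * unitClip ε a) ∂ν
      = 2 * (∫ u, unitClip ε (a + u) ∂ν - unitClip ε a) := by
    rw [integral_sub (by exact i1.add i2) (integrable_const _), integral_add i1 i2, h1]
    simp
    ring
  have h3 : |∫ u, (unitClip ε (a + u) + unitClip ε (a - u) - 2 * unitClip ε a) ∂ν|
      ≤ 6 / ε * |a| * σ := by
    calc _ ≤ ∫ u, 6 / ε * |a| * |u| ∂ν := by
          rw [← Real.norm_eq_abs]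
          refine norm_integral_le_of_norm_le (hν.integrable_abs.const_mul _) (ae_of_all _ fun u => ?_)
          have := abs_unitClip_second_difference_le hε a u
          rw [Real.norm_eq_abs]
          linarith
      _ = 6 / ε * |a| * ∫ u, |u| ∂ν := integral_const_mul _ _
      _ ≤ _ := mul_le_mul_of_nonneg_left hν.integral_abs_le (by positivity)
  rw [h2, abs_mul, abs_two] at h3
  have hs := Real.sqrt_pos.2 hε
  have h4 : |∫ u, unitClip ε (a + u) ∂ν - unitClip ε a| ≤ 3 / ε * |a| * σ := by
    have : 6 / ε * |a| * σ = 2 * (3 / ε * |a| * σ) := by ring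
    linarith
  rw [← sqrt_mul_unitClip, ← mul_sub, abs_mul, abs_of_pos hs]
  calc _ ≤ √ε * (3 / ε * |a| * σ) := mul_le_mul_of_nonneg_left h4 hs.le
    _ = 3 * σ * |a| / √ε := by
      have hq : ε = √ε * √ε := (Real.mul_self_sqrt hε.le).symm
      rw [show √ε * (3 / ε * |a| * σ) = 3 * σ * |a| * (√ε / ε) by ring]
      nth_rw 2 [hq]
      field_simp

/-! ### Gradients of functions with a bounded Hessian -/

/-- For a symmetric form `A` with `μ ≤ A ≤ L`, the Cauchy-Schwarz inequality of `A - μ` followed by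
Young's inequality, in a form that also covers `L = μ`. -/
theorem two_mul_bilin_sub_le {E : Type*} [NormedAddCommGroup E] [InnerProductSpace ℝ E]
    {A : E →L[ℝ] E →L[ℝ] ℝ} {μ L : ℝ} (hsymm : ∀ v w, A v w = A w v)
    (hlower : ∀ v, μ * ‖v‖ ^ 2 ≤ A v v) (hupper : ∀ v, A v v ≤ L * ‖v‖ ^ 2) (hμL : μ ≤ L) (v w : E) :
    2 * (A v w - μ * inner ℝ v w) ≤ (L - μ) * (A v v - μ * ‖v‖ ^ 2) + ‖w‖ ^ 2 := by
  rcases hμL.eq_or_lt with rfl | hμL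
  · have h := hupper (v + w)
    simp only [map_add, add_apply, hsymm w v, norm_add_sq_real] at h
    nlinarith [hlower v, hlower w, sq_nonneg ‖w‖]
  · have h := hlower ((L - μ) • v - w)
    simp only [map_sub, map_smul, sub_apply, smul_apply, smul_eq_mul, hsymm w v, norm_sub_sq_real,
      norm_smul, mul_pow, Real.norm_eq_abs, sq_abs, inner_smul_left, conj_trivial] at h
    have h2 : 0 ≤ (L - μ) * ((L - μ) * (A v v - μ * ‖v‖ ^ 2) + ‖w‖ ^ 2
        - 2 * (A v w - μ * inner ℝ v w)) := by nlinarith [hupper w]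
    linarith [(mul_nonneg_iff_of_pos_left (sub_pos.2 hμL)).1 h2]

namespace HessianBounds

variable {d : ℕ} {μ L : ℝ} {f : Vec d → ℝ}

theorem differentiable_fderiv (hf : HessianBounds μ L f) : Differentiable ℝ (fderiv ℝ f) :=
  (hf.contDiff.fderiv_right (m := 1) (by norm_num)).differentiable (by norm_num)

theorem continuous_gradient (hf : HessianBounds μ L f) : Continuous (gradient f) :=
  (InnerProductSpace.toDual ℝ (Vec d)).symm.continuous.comp hf.differentiable_fderiv.continuous

theorem fderiv_fderiv_symm (hf : HessianBounds μ L f) (x v w : Vec d) :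
    fderiv ℝ (fderiv ℝ f) x v w = fderiv ℝ (fderiv ℝ f) x w v :=
  (hf.contDiff.contDiffAt.isSymmSndFDerivAt (by simp)) v w

theorem exists_inner_gradient_sub_eq (hf : HessianBounds μ L f) (x y w : Vec d) :
    ∃ z, inner ℝ (gradient f x - gradient f y) w = fderiv ℝ (fderiv ℝ f) z (x - y) w := by
  have hd : ∀ s : ℝ, HasDerivAt (fun s : ℝ => fderiv ℝ f (y + s • (x - y)) w)
      (fderiv ℝ (fderiv ℝ f) (y + s • (x - y)) (x - y) w) s := fun s => by
    have h1 : HasDerivAt (fun s : ℝ => y + s • (x - y)) (x - y) s := by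
      simpa using ((hasDerivAt_id s).smul_const (x - y)).const_add y
    have h2 := (hf.differentiable_fderiv (y + s • (x - y))).hasFDerivAt.comp_hasDerivAt s h1
    simpa using h2.clm_apply (hasDerivAt_const s w)
  obtain ⟨s, -, hs⟩ := exists_hasDerivAt_eq_slope _ _ zero_lt_one
    (fun s _ => (hd s).continuousAt.continuousWithinAt) (fun s _ => hd s)
  refine ⟨_, Eq.trans ?_ hs.symm⟩
  simp [inner_sub_left, inner_gradient_left]

/-- Strong convexity, as strong monotonicity of the gradient. -/
theorem le_inner_gradient_sub (hf : HessianBounds μ L f) (x y : Vec d) :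
    μ * ‖x - y‖ ^ 2 ≤ inner ℝ (gradient f x - gradient f y) (x - y) := by
  obtain ⟨z, hz⟩ := hf.exists_inner_gradient_sub_eq x y (x - y)
  exact hz ▸ hf.lower z _

/-- Cocoercivity of `∇f - μ`. The mean value theorem is applied to the gradient paired with a
fixed vector, chosen so that one intermediate Hessian is enough. -/
theorem norm_gradient_sub_sub_sq_le (hf : HessianBounds μ L f) (hμL : μ ≤ L) (x y : Vec d) :
    ‖gradient f x - gradient f y - μ • (x - y)‖ ^ 2
      ≤ (L - μ) * inner ℝ (gradient f x - gradient f y - μ • (x - y)) (x - y) := by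
  set v := x - y with hv
  set g := gradient f x - gradient f y - μ • v with hg
  obtain ⟨z, hz⟩ := hf.exists_inner_gradient_sub_eq x y ((2 : ℝ) • g - (L - μ) • v)
  rw [← hv] at hz
  have h1 := two_mul_bilin_sub_le (hf.fderiv_fderiv_symm z) (hf.lower z) (hf.upper z) hμL v g
  have h2 : inner ℝ g ((2 : ℝ) • g - (L - μ) • v)
      = 2 * (fderiv ℝ (fderiv ℝ f) z v g - μ * inner ℝ v g)
        - (L - μ) * (fderiv ℝ (fderiv ℝ f) z v v - μ * ‖v‖ ^ 2) := by
    nth_rw 1 [hg]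
    rw [inner_sub_left, hz, inner_smul_left, inner_sub_right, inner_smul_right,
      inner_smul_right, map_sub, map_smul, map_smul, real_inner_self_eq_norm_sq]
    simp only [conj_trivial, smul_eq_mul]
    ring
  rw [inner_sub_right, inner_smul_right, inner_smul_right, real_inner_self_eq_norm_sq] at h2
  linarith

theorem norm_gradient_sub_sq_le (hf : HessianBounds μ L f) (hμL : μ ≤ L) (x y : Vec d) :
    ‖gradient f x - gradient f y‖ ^ 2
      ≤ (L + μ) * inner ℝ (gradient f x - gradient f y) (x - y) - μ * L * ‖x - y‖ ^ 2 := by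
  have h := hf.norm_gradient_sub_sub_sq_le hμL x y
  set g := gradient f x - gradient f y
  rw [norm_sub_sq_real, inner_sub_left g, inner_smul_left, inner_smul_right, norm_smul,
    real_inner_self_eq_norm_sq, Real.norm_eq_abs, mul_pow, sq_abs] at h
  simp only [conj_trivial] at h
  linarith

theorem norm_gradient_sub_le (hf : HessianBounds μ L f) (hμ : 0 ≤ μ) (hμL : μ ≤ L) (x y : Vec d) :
    ‖gradient f x - gradient f y‖ ≤ L * ‖x - y‖ := by
  have h := hf.norm_gradient_sub_sub_sq_le hμL x y
  set g := gradient f x - gradient f y - μ • (x - y) with hg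
  have h2 : ‖g‖ ≤ (L - μ) * ‖x - y‖ := by
    by_contra! hlt
    have h3 := real_inner_le_norm g (x - y)
    have h4 : 0 ≤ (L - μ) * ‖x - y‖ := mul_nonneg (by linarith) (norm_nonneg _)
    nlinarith [mul_le_mul_of_nonneg_left h3 (sub_nonneg.2 hμL)]
  calc _ = ‖g + μ • (x - y)‖ := by rw [hg, sub_add_cancel]
    _ ≤ ‖g‖ + ‖μ • (x - y)‖ := norm_add_le _ _
    _ ≤ _ := by rw [norm_smul, Real.norm_of_nonneg hμ]; linarith

end HessianBounds

theorem sum_gradient_eq_zero_of_isMin {n d : ℕ} {f : Fin n → Vec d → ℝ}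
    (hf : ∀ i, Differentiable ℝ (f i)) {x₀ : Vec d}
    (hmin : ∀ x, (1 / (n : ℝ)) * ∑ i, f i x₀ ≤ (1 / (n : ℝ)) * ∑ i, f i x) :
    ∑ i, gradient (f i) x₀ = 0 := by
  rcases n.eq_zero_or_pos with rfl | hn
  · simp
  have hn' : (0 : ℝ) < 1 / (n : ℝ) := by positivity
  have h1 : IsLocalMin (fun x => ∑ i, f i x) x₀ :=
    Eventually.of_forall fun x => le_of_mul_le_mul_left (hmin x) hn'
  have h2 := h1.fderiv_eq_zero
  rw [fderiv_fun_sum fun i _ => hf i x₀] at h2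
  simp only [gradient]
  rw [← map_sum, h2, map_zero]

/-! ### Descent along a componentwise rescaled gradient -/

/-- Writing each weight as the midpoint `(1 + s) / 2` plus a deviation of at most `(1 - s) / 2`
reduces a weighted inner product to the unweighted one. -/
theorem sum_mul_mul_ge {d : ℕ} (v g : Vec d) (S : Fin d → ℝ) {s : ℝ} (hs : ∀ k, s ≤ S k)
    (hS : ∀ k, S k ≤ 1) :
    (1 + s) / 2 * inner ℝ g v - (1 - s) / 2 * (‖v‖ * ‖g‖) ≤ ∑ k, S k * (v k * g k) := by
  rcases d.eq_zero_or_pos with rfl | hd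
  · simp [Subsingleton.elim v 0]
  have hs1 : s ≤ 1 := (hs ⟨0, hd⟩).trans (hS _)
  have h1 : inner ℝ g v = ∑ k, v k * g k := by
    simp [PiLp.inner_apply]
  have h2 : ∑ k, |v k| * |g k| ≤ ‖v‖ * ‖g‖ := by
    have := Real.sum_mul_le_sqrt_mul_sqrt Finset.univ (fun k => |v k|) (fun k => |g k|)
    simpa [EuclideanSpace.norm_eq] using this
  have h3 : ∀ k, (1 + s) / 2 * (v k * g k) - (1 - s) / 2 * (|v k| * |g k|) ≤ S k * (v k * g k) :=
    fun k => by
      rw [← abs_mul]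
      rcases abs_cases (v k * g k) with ⟨h, h'⟩ | ⟨h, h'⟩ <;> rw [h] <;> nlinarith [hs k, hS k]
  calc _ ≤ ∑ k, ((1 + s) / 2 * (v k * g k) - (1 - s) / 2 * (|v k| * |g k|)) := by
        rw [Finset.sum_sub_distrib, ← Finset.mul_sum, ← Finset.mul_sum, h1]
        have := mul_le_mul_of_nonneg_left h2 (show 0 ≤ (1 - s) / 2 by linarith)
        linarith
    _ ≤ _ := Finset.sum_le_sum fun k _ => h3 k

/-- If `√(κ - 1) ρ ≤ 1 / 10`, then clipping by a factor as small as `s = 1 / √(1 + ρ)` still leaves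
an acute angle: `(κ + 1) / (2 √κ)` bounds `‖v‖ ‖H v‖ / ⟪v, H v⟫` for operators `H` with condition
number `κ`. -/
theorem one_sub_mul_kantorovich_le_one {κ ρ : ℝ} (hκ : 1 ≤ κ) (hρ : 0 ≤ ρ)
    (h : ρ * √(κ - 1) ≤ 1 / 10) :
    (1 - 1 / √(1 + ρ)) * ((κ + 1) / (2 * √κ)) ≤ 1 := by
  obtain ⟨w, hw⟩ : ∃ w, w = √(κ - 1) := ⟨_, rfl⟩
  have hw0 : 0 ≤ w := hw ▸ Real.sqrt_nonneg _
  have hκw : κ = 1 + w ^ 2 := by rw [hw, Real.sq_sqrt (by linarith)]; ring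
  rw [← hw] at h
  obtain ⟨s, hs⟩ : ∃ s, s = 1 / √(1 + ρ) := ⟨_, rfl⟩
  have hs0 : 0 < s := hs ▸ by positivity
  have hs2 : s ^ 2 * (1 + ρ) = 1 := by
    rw [hs, div_pow, Real.sq_sqrt (by positivity)]; field_simp
  have hs1 : s ≤ 1 := by nlinarith
  rw [← hs, hκw]
  have hr := Real.sqrt_pos.2 (show 0 < 1 + w ^ 2 by positivity)
  have hr2 := Real.sq_sqrt (show 0 ≤ 1 + w ^ 2 by positivity)
  set r := √(1 + w ^ 2)
  -- for `w ≤ 1` the Kantorovich factor is near one, and `s` is bounded below; for `w ≥ 1` the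
  -- hypothesis makes `1 - s` small enough to offset its growth
  rcases le_total w 1 with hw1 | hw1
  · have hK : (1 + w ^ 2 + 1) / (2 * r) ≤ 1 + w ^ 4 / 8 := by
      rw [div_le_iff₀ (by positivity)]
      refine le_of_sq_le_sq ?_ (by positivity)
      have : ((1 + w ^ 4 / 8) * (2 * r)) ^ 2 = (1 + w ^ 4 / 8) ^ 2 * (4 * (1 + w ^ 2)) := by
        rw [← hr2]; ring
      rw [this]
      have : (1 + w ^ 4 / 8) ^ 2 * (4 * (1 + w ^ 2)) - (1 + w ^ 2 + 1) ^ 2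
        = w ^ 6 + w ^ 8 / 16 * (1 + w ^ 2) := by ring
      nlinarith [show 0 ≤ w ^ 6 + w ^ 8 / 16 * (1 + w ^ 2) by positivity]
    have hws : w ^ 4 / 8 ≤ s := by
      by_contra! hlt
      have h1 : s ^ 2 ≤ (w ^ 4 / 8) ^ 2 := by gcongr
      have h2 : w ^ 8 ≤ 1 := pow_le_one₀ hw0 hw1
      have h3 : w ^ 8 ≤ w := by
        simpa using pow_le_pow_of_le_one hw0 hw1 (show 1 ≤ 8 by norm_num)
      nlinarith [mul_le_mul_of_nonneg_right h1 (show 0 ≤ 1 + ρ by positivity),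
        mul_le_mul_of_nonneg_left h3 hρ]
    calc _ ≤ (1 - s) * (1 + w ^ 4 / 8) := mul_le_mul_of_nonneg_left hK (by linarith)
      _ ≤ (1 - s) * (1 + s) := mul_le_mul_of_nonneg_left (by linarith) (by linarith)
      _ ≤ 1 := by nlinarith
  · have hρ1 : ρ ≤ 1 / 10 := by nlinarith
    have hs3 : 1 - s ≤ ρ / 2 := by
      by_contra! hlt
      have h1 : s ^ 2 < (1 - ρ / 2) ^ 2 := by gcongr; linarith
      nlinarith [mul_lt_mul_of_pos_right h1 (show 0 < 1 + ρ by positivity), sq_nonneg ρ]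
    have hwr : w ≤ r := by nlinarith
    have hK : (1 + w ^ 2 + 1) / (2 * r) ≤ 3 / 2 * w := by
      rw [div_le_iff₀ (by positivity)]
      nlinarith
    calc _ ≤ ρ / 2 * (3 / 2 * w) := mul_le_mul hs3 hK (by positivity) (by positivity)
      _ ≤ 1 := by nlinarith

/-- Kantorovich's inequality, for a gradient difference `g` that satisfies the cocoercivity
estimate in place of `g = H v`. -/
theorem norm_mul_norm_le_kantorovich {E : Type*} [NormedAddCommGroup E] [InnerProductSpace ℝ E]
    {μ L : ℝ} (hμ : 0 < μ) (hμL : μ ≤ L) {v g : E} (h0 : 0 ≤ inner ℝ g v)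
    (h : ‖g‖ ^ 2 ≤ (L + μ) * inner ℝ g v - μ * L * ‖v‖ ^ 2) :
    ‖v‖ * ‖g‖ ≤ (L / μ + 1) / (2 * √(L / μ)) * inner ℝ g v := by
  have hL : 0 < L := hμ.trans_le hμL
  set q := inner ℝ g v
  refine le_of_sq_le_sq ?_ (by positivity)
  have e : ((L / μ + 1) / (2 * √(L / μ)) * q) ^ 2 = ((L + μ) * q) ^ 2 / (4 * (μ * L)) := by
    rw [mul_pow, div_pow, mul_pow, Real.sq_sqrt (by positivity)]
    field_simp
    ring
  rw [e, le_div_iff₀ (by positivity), mul_pow]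
  nlinarith [sq_nonneg ((L + μ) * q - 2 * (μ * L) * ‖v‖ ^ 2),
    mul_le_mul_of_nonneg_left h (show 0 ≤ ‖v‖ ^ 2 * (4 * (μ * L)) by positivity)]

/-- A gradient difference stays a descent direction after its components are rescaled by different
factors in `[1 / √(1 + ρ), 1]`. The surviving modulus of convexity involves only a bound `ρ₀` of
`ρ`. -/
theorem HessianBounds.le_sum_shrunk_gradient {d : ℕ} {μ L : ℝ} {f : Vec d → ℝ}
    (hf : HessianBounds μ L f) (hμ : 0 < μ) (hμL : μ ≤ L) {ρ ρ₀ : ℝ} (hρ : 0 ≤ ρ) (hρ₀ : ρ ≤ ρ₀)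
    (hρκ : ρ * √(L / μ - 1) ≤ 1 / 10) (x y : Vec d) (S : Fin d → ℝ)
    (hs : ∀ k, 1 / √(1 + ρ) ≤ S k) (hS : ∀ k, S k ≤ 1) :
    1 / (2 * √(1 + ρ₀)) * μ * ‖x - y‖ ^ 2
      ≤ ∑ k, S k * ((x - y) k * (gradient f x - gradient f y) k) := by
  refine le_trans ?_ (sum_mul_mul_ge (x - y) (gradient f x - gradient f y) S hs hS)
  have h1 := hf.le_inner_gradient_sub x y
  have h0 : 0 ≤ μ * ‖x - y‖ ^ 2 := by positivity
  have h2 := norm_mul_norm_le_kantorovich hμ hμL (h0.trans h1) (hf.norm_gradient_sub_sq_le hμL x y)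
  have h3 := one_sub_mul_kantorovich_le_one ((one_le_div hμ).2 hμL) hρ hρκ
  have hs1 : 1 / √(1 + ρ) ≤ 1 := by
    rw [div_le_one (by positivity)]
    exact Real.one_le_sqrt.2 (by linarith)
  have h4 : 1 / √(1 + ρ₀) ≤ 1 / √(1 + ρ) :=
    one_div_le_one_div_of_le (by positivity) (Real.sqrt_le_sqrt (by linarith))
  have h5 : 1 / (2 * √(1 + ρ₀)) = 1 / √(1 + ρ₀) / 2 := by ring
  have h6 : 0 < 1 / √(1 + ρ₀) := by
    have := hρ.trans hρ₀
    positivity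
  rw [h5]
  set q := inner ℝ (gradient f x - gradient f y) (x - y)
  set s := 1 / √(1 + ρ)
  have hq : 0 ≤ q := h0.trans h1
  calc _ = 1 / √(1 + ρ₀) / 2 * (μ * ‖x - y‖ ^ 2) := by ring
    _ ≤ s / 2 * q := mul_le_mul (by linarith) h1 h0 (by linarith)
    _ ≤ (1 + s) / 2 * q - (1 - s) / 2 * ((L / μ + 1) / (2 * √(L / μ)) * q) := by
      nlinarith [mul_le_mul_of_nonneg_right h3 hq]
    _ ≤ _ := by linarith [mul_le_mul_of_nonneg_left h2 (show 0 ≤ (1 - s) / 2 by linarith)]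

/-! ### A Chung-type recursion -/

/-- The comparison sequence `(t + 1)^(-γ)` decays no faster than a recursion with rate `γ`. -/
theorem rpow_neg_succ_ge {γ : ℝ} (hγ : 0 ≤ γ) (t : ℕ) :
    (1 - γ / ((t : ℝ) + 1)) * ((t : ℝ) + 1) ^ (-γ) ≤ ((t : ℝ) + 1 + 1) ^ (-γ) := by
  have ht : (0 : ℝ) < (t : ℝ) + 1 := by positivity
  have h1 : (t : ℝ) + 1 + 1 = (1 + 1 / ((t : ℝ) + 1)) * ((t : ℝ) + 1) := by field_simp
  rw [h1, Real.mul_rpow (by positivity) ht.le]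
  refine mul_le_mul_of_nonneg_right ?_ (by positivity)
  calc 1 - γ / ((t : ℝ) + 1) ≤ Real.exp (-γ / ((t : ℝ) + 1)) := by
        have := Real.add_one_le_exp (-γ / ((t : ℝ) + 1))
        rw [neg_div] at this ⊢
        linarith
    _ = Real.exp (1 / ((t : ℝ) + 1)) ^ (-γ) := by
        rw [← Real.exp_mul]; congr 1; ring
    _ ≤ _ := Real.rpow_le_rpow_of_nonpos (by positivity)
        (by linarith [Real.add_one_le_exp (1 / ((t : ℝ) + 1))]) (by linarith)

/-- A Chung-type lemma, by comparison with `K (t + 1)^(-γ)` for some `γ` strictly between `δ` and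
`min c (2 / 5)`. -/
theorem tendsto_rpow_mul_of_recursion {e : ℕ → ℝ} {c C δ : ℝ} (he : ∀ t, 0 ≤ e t) (hδ : 0 < δ)
    (hδc : δ < c) (hδ2 : δ < 2 / 5)
    (hrec : ∀ᶠ t : ℕ in atTop,
      e (t + 1) ≤ (1 - c / ((t : ℝ) + 1)) * e t + C * ((t : ℝ) + 1) ^ (-(7 / 5) : ℝ)) :
    Tendsto (fun t : ℕ => ((t : ℝ) + 1) ^ δ * e t) atTop (𝓝 0) := by
  obtain ⟨γ, hγ1, hγ2⟩ := exists_between (lt_min hδc hδ2)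
  obtain ⟨hγc, hγ25⟩ := lt_min_iff.1 hγ2
  have hγ0 : 0 < γ := hδ.trans hγ1
  obtain ⟨T, hT⟩ := eventually_atTop.1
    (hrec.and ((tendsto_natCast_atTop_atTop (R := ℝ)).eventually_ge_atTop c))
  obtain ⟨K, hK1, hK2⟩ : ∃ K, C ≤ K * (c - γ) ∧ e T ≤ K * ((T : ℝ) + 1) ^ (-γ) := by
    have h1 : 0 < c - γ := by linarith
    have h2 : 0 < ((T : ℝ) + 1) ^ (-γ) := by positivity
    refine ⟨max (C / (c - γ)) (e T / ((T : ℝ) + 1) ^ (-γ)), ?_, ?_⟩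
    · rw [← div_le_iff₀ h1]; exact le_max_left _ _
    · rw [← div_le_iff₀ h2]; exact le_max_right _ _
  have hK : 0 ≤ K := by
    have : 0 ≤ K * ((T : ℝ) + 1) ^ (-γ) := (he T).trans hK2
    exact nonneg_of_mul_nonneg_left this (by positivity)
  have hbound : ∀ t, T ≤ t → e t ≤ K * ((t : ℝ) + 1) ^ (-γ) := fun t ht => by
    induction t, ht using Nat.le_induction with
    | base => exact hK2
    | succ t ht ih =>
      obtain ⟨h1, h2⟩ := hT t ht
      have ht0 : (0 : ℝ) < (t : ℝ) + 1 := by positivity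
      have h3 : 0 ≤ 1 - c / ((t : ℝ) + 1) := by
        rw [sub_nonneg, div_le_one ht0]; linarith
      have h4 : ((t : ℝ) + 1) ^ (-(7 / 5) : ℝ) ≤ ((t : ℝ) + 1) ^ (-γ) / ((t : ℝ) + 1) := by
        rw [← Real.rpow_sub_one ht0.ne']
        exact Real.rpow_le_rpow_of_exponent_le (by linarith [t.cast_nonneg (α := ℝ)]) (by linarith)
      have h5 := rpow_neg_succ_ge hγ0.le t
      have h6 := mul_le_mul_of_nonneg_left ih h3
      have h7 : 0 ≤ ((t : ℝ) + 1) ^ (-(7 / 5) : ℝ) := by positivity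
      push_cast
      calc e (t + 1) ≤ (1 - c / ((t : ℝ) + 1)) * (K * ((t : ℝ) + 1) ^ (-γ))
            + K * (c - γ) * (((t : ℝ) + 1) ^ (-γ) / ((t : ℝ) + 1)) := by
            have h8 := mul_le_mul_of_nonneg_right hK1 h7
            have h9 := mul_le_mul_of_nonneg_left h4
              (mul_nonneg hK (show 0 ≤ c - γ by linarith))
            linarith
        _ = K * ((1 - γ / ((t : ℝ) + 1)) * ((t : ℝ) + 1) ^ (-γ)) := by ring
        _ ≤ _ := mul_le_mul_of_nonneg_left h5 hK
  have hlim : Tendsto (fun t : ℕ => K * ((t : ℝ) + 1) ^ (-(γ - δ))) atTop (𝓝 0) := by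
    have h1 := (tendsto_rpow_neg_atTop (sub_pos.2 hγ1)).comp
      ((tendsto_natCast_atTop_atTop (R := ℝ)).atTop_add (tendsto_const_nhds (x := (1 : ℝ))))
    simpa using h1.const_mul K
  refine tendsto_of_tendsto_of_tendsto_of_le_of_le' tendsto_const_nhds hlim
    (Eventually.of_forall fun t => mul_nonneg (by positivity) (he t)) ?_
  filter_upwards [eventually_ge_atTop T] with t ht
  have ht0 : (0 : ℝ) < (t : ℝ) + 1 := by positivity
  calc _ ≤ ((t : ℝ) + 1) ^ δ * (K * ((t : ℝ) + 1) ^ (-γ)) :=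
        mul_le_mul_of_nonneg_left (hbound t ht) (by positivity)
    _ = _ := by rw [show -(γ - δ) = δ + -γ by ring, Real.rpow_add ht0]; ring

/-! ### Deterministic bounds on the iterates -/

theorem EuclideanSpace.norm_le_sqrt_mul {d : ℕ} {y : Vec d} {b : ℝ} (hb : 0 ≤ b)
    (hy : ∀ k, |y k| ≤ b) : ‖y‖ ≤ √d * b := by
  rw [EuclideanSpace.norm_eq]
  refine Real.sqrt_le_iff.2 ⟨by positivity, ?_⟩
  calc ∑ k, ‖y k‖ ^ 2 ≤ ∑ _k : Fin d, b ^ 2 := Finset.sum_le_sum fun k _ => by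
        rw [Real.norm_eq_abs]
        exact pow_le_pow_left₀ (abs_nonneg _) (hy k) 2
    _ = (√d * b) ^ 2 := by
        rw [mul_pow, Real.sq_sqrt (Nat.cast_nonneg d)]
        simp

theorem norm_smul_sum_le {n d : ℕ} {η b : ℝ} (hη : 0 ≤ η) (hb : 0 ≤ b) {m : Fin n → Vec d}
    (hm : ∀ i k, |m i k| ≤ b) : ‖(η / (n : ℝ)) • ∑ i, m i‖ ≤ η * (√d * b) := by
  rcases n.eq_zero_or_pos with rfl | hn
  · simpa using by positivity
  have hn' : (0 : ℝ) < n := by positivity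
  have h1 : ‖∑ i, m i‖ ≤ n * (√d * b) := by
    refine (norm_sum_le _ _).trans ?_
    refine (Finset.sum_le_card_nsmul _ _ _ fun i _ =>
      EuclideanSpace.norm_le_sqrt_mul hb (hm i)).trans ?_
    simp
  rw [norm_smul, Real.norm_of_nonneg (by positivity)]
  calc _ ≤ η / n * (n * (√d * b)) := mul_le_mul_of_nonneg_left h1 (by positivity)
    _ = _ := by field_simp

/-- Bernoulli's inequality, as a telescoping bound for the sum of the step lengths. -/
theorem rpow_neg_le_sub (t : ℕ) :
    ((t : ℝ) + 1) ^ (-(7 / 10) : ℝ)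
      ≤ 10 / 3 * (((t : ℝ) + 1) ^ (3 / 10 : ℝ) - (t : ℝ) ^ (3 / 10 : ℝ)) := by
  have ht : (0 : ℝ) < (t : ℝ) + 1 := by positivity
  have h1 : (t : ℝ) = (1 + -(1 / ((t : ℝ) + 1))) * ((t : ℝ) + 1) := by field_simp; ring
  have hx : 1 / ((t : ℝ) + 1) ≤ 1 := by
    rw [div_le_one ht]; linarith [t.cast_nonneg (α := ℝ)]
  have h2 := rpow_one_add_le_one_add_mul_self (s := -(1 / ((t : ℝ) + 1))) (by linarith)
    (p := 3 / 10) (by norm_num) (by norm_num)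
  have h3 : (t : ℝ) ^ (3 / 10 : ℝ)
      ≤ (1 + 3 / 10 * -(1 / ((t : ℝ) + 1))) * ((t : ℝ) + 1) ^ (3 / 10 : ℝ) := by
    nth_rw 1 [h1]
    rw [Real.mul_rpow (by linarith) ht.le]
    exact mul_le_mul_of_nonneg_right h2 (by positivity)
  have h4 : ((t : ℝ) + 1) ^ (-(7 / 10) : ℝ) = 1 / ((t : ℝ) + 1) * ((t : ℝ) + 1) ^ (3 / 10 : ℝ) := by
    rw [show (-(7 / 10) : ℝ) = 3 / 10 - 1 by norm_num, Real.rpow_sub_one ht.ne']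
    ring
  rw [h4]
  linarith

theorem feedback_apply {d : ℕ} (θ : ClipParams) (t : ℕ) (m g : Vec d) (k : Fin d) :
    feedback θ t m g k
      = θ.β t * m k + (1 - θ.β t) * (θ.φ t * unitClip (θ.ε t) (g k - m k)) := by
  simp [feedback, smoothClip_apply]

theorem abs_feedback_le {d : ℕ} {θ : ClipParams} {t : ℕ} (hφ : 0 ≤ θ.φ t) (hε : 0 ≤ θ.ε t)
    (hβ : 0 ≤ θ.β t) (hβ1 : θ.β t ≤ 1) (m g : Vec d) (k : Fin d) :
    |feedback θ t m g k| ≤ θ.β t * |m k| + (1 - θ.β t) * θ.φ t := by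
  rw [feedback_apply]
  refine (abs_add_le _ _).trans ?_
  rw [abs_mul, abs_mul, abs_mul, abs_of_nonneg hβ, abs_of_nonneg hφ,
    abs_of_nonneg (sub_nonneg.2 hβ1)]
  have := mul_le_mul_of_nonneg_left (abs_unitClip_le_one hε (g k - m k)) hφ
  have := mul_le_mul_of_nonneg_left this (sub_nonneg.2 hβ1)
  linarith

/-- The sign conditions on the constants of the schedule. -/
structure ScheduleConstants (cφ τ cβ cη : ℝ) : Prop where
  φ_pos : 0 < cφ
  τ_pos : 0 < τ
  β_nonneg : 0 ≤ cβ
  β_lt_one : cβ < 1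
  η_pos : 0 < cη

namespace ScheduleConstants

variable {cφ τ cβ cη : ℝ}

theorem ε_pos (hc : ScheduleConstants cφ τ cβ cη) (t : ℕ) : 0 < (schedule cφ τ cβ cη).ε t := by
  have := hc.τ_pos
  simp only [schedule]
  positivity

theorem sqrt_ε (hc : ScheduleConstants cφ τ cβ cη) (t : ℕ) :
    √((schedule cφ τ cβ cη).ε t) = √τ * ((t : ℝ) + 1) ^ (3 / 10 : ℝ) := by
  have ht : (0 : ℝ) < (t : ℝ) + 1 := by positivity
  simp only [schedule]
  rw [Real.sqrt_mul hc.τ_pos.le, Real.sqrt_eq_rpow (_ ^ _), ← Real.rpow_mul ht.le]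
  norm_num

theorem schedule_β_nonneg (hc : ScheduleConstants cφ τ cβ cη) (t : ℕ) :
    0 ≤ (schedule cφ τ cβ cη).β t :=
  div_nonneg hc.β_nonneg (Real.sqrt_nonneg _)

theorem schedule_β_le_one (hc : ScheduleConstants cφ τ cβ cη) (t : ℕ) :
    (schedule cφ τ cβ cη).β t ≤ 1 :=
  div_le_one_of_le₀ (hc.β_lt_one.le.trans
    (Real.one_le_sqrt.2 (by linarith [t.cast_nonneg (α := ℝ)]))) (Real.sqrt_nonneg _)

theorem schedule_φ_nonneg (hc : ScheduleConstants cφ τ cβ cη) (t : ℕ) :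
    0 ≤ (schedule cφ τ cβ cη).φ t :=
  div_nonneg hc.φ_pos.le (Real.sqrt_nonneg _)

theorem schedule_η_nonneg (hc : ScheduleConstants cφ τ cβ cη) (t : ℕ) :
    0 ≤ (schedule cφ τ cβ cη).η t :=
  div_nonneg hc.η_pos.le (by positivity)

variable {n d : ℕ}

theorem abs_estimator_le (hc : ScheduleConstants cφ τ cβ cη)
    (g : ℕ → Fin n → Vec d → Vec d) (x₀ : Vec d) (t : ℕ) (i : Fin n) (k : Fin d) :
    |(sclipEF (schedule cφ τ cβ cη) g x₀ t).2 i k| ≤ cφ := by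
  induction t with
  | zero => simpa [sclipEF] using hc.φ_pos.le
  | succ t ih =>
    refine (abs_feedback_le (hc.schedule_φ_nonneg t) (hc.ε_pos t).le (hc.schedule_β_nonneg t)
      (hc.schedule_β_le_one t) _ _ k).trans ?_
    have h1 := mul_le_mul_of_nonneg_left ih (hc.schedule_β_nonneg t)
    have h2 : (schedule cφ τ cβ cη).φ t ≤ cφ :=
      div_le_self hc.φ_pos.le (Real.one_le_sqrt.2 (by linarith [t.cast_nonneg (α := ℝ)]))
    have h3 := mul_le_mul_of_nonneg_left h2 (sub_nonneg.2 (hc.schedule_β_le_one t))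
    linarith

theorem abs_estimator_succ_le_of_le (hc : ScheduleConstants cφ τ cβ cη)
    (g : ℕ → Fin n → Vec d → Vec d) (x₀ : Vec d) {b : ℝ} {t : ℕ} {i : Fin n} {k : Fin d}
    (h : |(sclipEF (schedule cφ τ cβ cη) g x₀ t).2 i k| ≤ b) :
    |(sclipEF (schedule cφ τ cβ cη) g x₀ (t + 1)).2 i k| ≤ (cφ + b) / √((t : ℝ) + 1) := by
  refine (abs_feedback_le (hc.schedule_φ_nonneg t) (hc.ε_pos t).le (hc.schedule_β_nonneg t)
    (hc.schedule_β_le_one t) _ _ k).trans ?_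
  have hs : 0 < √((t : ℝ) + 1) := by positivity
  have h0 : 0 ≤ b := (abs_nonneg _).trans h
  have h1 := mul_le_mul_of_nonneg_left h (hc.schedule_β_nonneg t)
  have h2 : (schedule cφ τ cβ cη).β t * b ≤ 1 / √((t : ℝ) + 1) * b :=
    mul_le_mul_of_nonneg_right (div_le_div_of_nonneg_right hc.β_lt_one.le hs.le) h0
  have h3 := mul_nonneg (hc.schedule_β_nonneg t) (hc.schedule_φ_nonneg t)
  calc _ ≤ 1 / √((t : ℝ) + 1) * b + (schedule cφ τ cβ cη).φ t := by linarith
    _ = _ := by simp only [schedule]; ring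

/-- The crude bound `cφ` on the estimators, fed once through the recursion; the factor `4` absorbs
the shift from `t` to `t + 1`. -/
theorem abs_estimator_le_div_sqrt (hc : ScheduleConstants cφ τ cβ cη)
    (g : ℕ → Fin n → Vec d → Vec d) (x₀ : Vec d) (t : ℕ) (i : Fin n) (k : Fin d) :
    |(sclipEF (schedule cφ τ cβ cη) g x₀ t).2 i k| ≤ 4 * cφ / √((t : ℝ) + 1) := by
  have hφ := hc.φ_pos
  cases t with
  | zero =>
    have : (0 : ℝ) ≤ 4 * cφ / √(((0 : ℕ) : ℝ) + 1) := by positivity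
    simpa [sclipEF] using this
  | succ t =>
    refine (hc.abs_estimator_succ_le_of_le g x₀ (hc.abs_estimator_le g x₀ t i k)).trans ?_
    rw [div_le_div_iff₀ (by positivity) (by positivity)]
    have h1 : √(((t + 1 : ℕ) : ℝ) + 1) ≤ 2 * √((t : ℝ) + 1) := by
      rw [Real.sqrt_le_left (by positivity), mul_pow, Real.sq_sqrt (by positivity)]
      push_cast
      linarith [t.cast_nonneg (α := ℝ)]
    nlinarith

/-- The leading term is the clipping height itself: the feedback from the previous estimator is of
lower order. This fixes the leading constant in the growth of the iterates. -/
theorem abs_estimator_succ_le (hc : ScheduleConstants cφ τ cβ cη)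
    (g : ℕ → Fin n → Vec d → Vec d) (x₀ : Vec d) (t : ℕ) (i : Fin n) (k : Fin d) :
    |(sclipEF (schedule cφ τ cβ cη) g x₀ (t + 1)).2 i k|
      ≤ cφ * (((t : ℝ) + 1) ^ (-(1 / 2) : ℝ) + 4 * ((t : ℝ) + 1) ^ (-1 : ℝ)) := by
  have ht : (0 : ℝ) < (t : ℝ) + 1 := by positivity
  refine (hc.abs_estimator_succ_le_of_le g x₀
    (hc.abs_estimator_le_div_sqrt g x₀ t i k)).trans (le_of_eq ?_)
  have h1 := Real.sq_sqrt ht.le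
  have h2 := Real.sqrt_pos.2 ht
  rw [Real.rpow_neg ht.le, ← Real.sqrt_eq_rpow, Real.rpow_neg_one]
  nth_rw 4 [← h1]
  field_simp

theorem norm_step_le (hc : ScheduleConstants cφ τ cβ cη)
    (g : ℕ → Fin n → Vec d → Vec d) (x₀ : Vec d) (t : ℕ) :
    ‖(sclipEF (schedule cφ τ cβ cη) g x₀ (t + 1)).1 - (sclipEF (schedule cφ τ cβ cη) g x₀ t).1‖
      ≤ √d * cη * cφ
        * (((t : ℝ) + 1) ^ (-(7 / 10) : ℝ) + 4 * ((t : ℝ) + 1) ^ (-(6 / 5) : ℝ)) := by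
  have ht : (0 : ℝ) < (t : ℝ) + 1 := by positivity
  have hφ := hc.φ_pos
  have h1 := norm_smul_sum_le (hc.schedule_η_nonneg t) (by positivity)
    (hc.abs_estimator_succ_le g x₀ t)
  have h2 : (sclipEF (schedule cφ τ cβ cη) g x₀ (t + 1)).1
      - (sclipEF (schedule cφ τ cβ cη) g x₀ t).1
      = -(((schedule cφ τ cβ cη).η t / (n : ℝ))
        • ∑ i, (sclipEF (schedule cφ τ cβ cη) g x₀ (t + 1)).2 i) := by
    simp [sclipEF]
  rw [h2, norm_neg]
  refine h1.trans (le_of_eq ?_)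
  rw [show (-(7 / 10) : ℝ) = -(1 / 5) + -(1 / 2) by norm_num,
    show (-(6 / 5) : ℝ) = -(1 / 5) + -1 by norm_num, Real.rpow_add ht, Real.rpow_add ht]
  simp only [schedule]
  rw [Real.rpow_neg ht.le (1 / 5)]
  ring

/-- The iterates grow at most like `t^(3/10)`, with an explicit leading constant; this growth is
what the parameter `ε t` has to dominate. -/
theorem exists_norm_sub_le (hc : ScheduleConstants cφ τ cβ cη)
    (x₀ : Vec d) (xstar : Vec d) : ∃ R, 0 ≤ R ∧ ∀ (g : ℕ → Fin n → Vec d → Vec d) (t : ℕ),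
    ‖(sclipEF (schedule cφ τ cβ cη) g x₀ t).1 - xstar‖
      ≤ R + 10 / 3 * (√d * cη * cφ) * ((t : ℝ) + 1) ^ (3 / 10 : ℝ) := by
  have hφ := hc.φ_pos
  have hη := hc.η_pos
  have hsum : Summable fun s : ℕ => ((s : ℝ) + 1) ^ (-(6 / 5) : ℝ) := by
    have := (summable_nat_add_iff 1).2
      (Real.summable_nat_rpow (p := -(6 / 5)).2 (by norm_num))
    simpa using this
  have hpos : ∀ s : ℕ, 0 ≤ ((s : ℝ) + 1) ^ (-(6 / 5) : ℝ) := fun s => by positivity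
  refine ⟨‖x₀ - xstar‖ + √d * cη * cφ * (4 * ∑' s : ℕ, ((s : ℝ) + 1) ^ (-(6 / 5) : ℝ)),
    by have := tsum_nonneg (L := .unconditional ℕ) hpos; positivity, fun g t => ?_⟩
  have key : ‖(sclipEF (schedule cφ τ cβ cη) g x₀ t).1 - x₀‖ ≤ √d * cη * cφ *
      (10 / 3 * (t : ℝ) ^ (3 / 10 : ℝ)
        + 4 * ∑ s ∈ Finset.range t, ((s : ℝ) + 1) ^ (-(6 / 5) : ℝ)) := by
    induction t with
    | zero => simp [sclipEF]
    | succ t ih =>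
      have h1 := hc.norm_step_le g x₀ t
      have h2 := mul_le_mul_of_nonneg_left (rpow_neg_le_sub t)
        (show 0 ≤ √d * cη * cφ by positivity)
      refine (norm_sub_le_norm_sub_add_norm_sub _
        (sclipEF (schedule cφ τ cβ cη) g x₀ t).1 _).trans ?_
      rw [Finset.sum_range_succ]
      push_cast
      linarith
  have h3 := hsum.sum_le_tsum (Finset.range t) fun s _ => hpos s
  have h4 : (t : ℝ) ^ (3 / 10 : ℝ) ≤ ((t : ℝ) + 1) ^ (3 / 10 : ℝ) :=
    Real.rpow_le_rpow (by positivity) (by linarith) (by norm_num)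
  have h5 := mul_le_mul_of_nonneg_left
    (show 10 / 3 * (t : ℝ) ^ (3 / 10 : ℝ)
        + 4 * ∑ s ∈ Finset.range t, ((s : ℝ) + 1) ^ (-(6 / 5) : ℝ)
      ≤ 10 / 3 * ((t : ℝ) + 1) ^ (3 / 10 : ℝ) + 4 * ∑' s : ℕ, ((s : ℝ) + 1) ^ (-(6 / 5) : ℝ)
      by linarith)
    (show 0 ≤ √d * cη * cφ by positivity)
  have h6 := norm_sub_le_norm_sub_add_norm_sub (sclipEF (schedule cφ τ cβ cη) g x₀ t).1 x₀ xstar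
  linarith

end ScheduleConstants

/-! ### The mean drift -/

/-- The mean, over noise of law `ν`, of `⟪x - x*, ∑ i, m_i'⟫`, where `m_i'` are the estimators that
follow the state `s = (x, m)` at iteration `t`. -/
noncomputable def meanDrift {n d : ℕ} (θ : ClipParams) (f : Fin n → Vec d → ℝ) (xstar : Vec d)
    (ν : Measure ℝ) (t : ℕ) (s : Vec d × (Fin n → Vec d)) : ℝ :=
  ∑ i, ∑ k, (s.1 - xstar) k * (θ.β t * s.2 i k + (1 - θ.β t) * (θ.φ t *
    ∫ u, unitClip (θ.ε t) (gradient (f i) s.1 k - s.2 i k + u) ∂ν))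

theorem abs_apply_le_norm {d : ℕ} (v : Vec d) (k : Fin d) : |v k| ≤ ‖v‖ := by
  simpa using PiLp.norm_apply_le v k

section Drift

variable {n d : ℕ} {μ L σ cstar : ℝ} {f : Fin n → Vec d → ℝ} {xstar : Vec d} {ν : Measure ℝ}

theorem abs_gradient_sub_le (hμ : 0 < μ) (hμL : μ ≤ L) (hf : ∀ i, HessianBounds μ L (f i))
    (hcstar : ∀ i k, |gradient (f i) xstar k| ≤ cstar) {x : Vec d} {m : Fin n → Vec d} {b : ℝ}
    (hm : ∀ i k, |m i k| ≤ b) (i : Fin n) (k : Fin d) :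
    |gradient (f i) x k - m i k| ≤ L * ‖x - xstar‖ + cstar + b := by
  have h1 := (abs_apply_le_norm (gradient (f i) x - gradient (f i) xstar) k).trans
    ((hf i).norm_gradient_sub_le hμ.le hμL x xstar)
  have h2 : gradient (f i) x k - m i k
      = ((gradient (f i) x - gradient (f i) xstar) k + gradient (f i) xstar k) + -m i k := by
    simp [sub_eq_add_neg]
  rw [h2]
  refine (abs_add_le _ _).trans (add_le_add ((abs_add_le _ _).trans (add_le_add h1 (hcstar i k))) ?_)
  rw [abs_neg]
  exact hm i k

/-- The expected clipped direction, rescaled by `√ε`, is the gradient difference shrunk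
componentwise, plus terms summing to zero over the nodes, plus an error of lower order. -/
theorem le_sum_mul_integral_unitClip [IsProbabilityMeasure ν] (hν : IsSymmetricNoise σ ν)
    (hσ : 0 ≤ σ) (hμ : 0 < μ) (hμL : μ ≤ L) (hf : ∀ i, HessianBounds μ L (f i))
    (hsum : ∑ i, gradient (f i) xstar = 0)
    (hcstar : ∀ i k, |gradient (f i) xstar k| ≤ cstar) {ε ρ ρ₀ b : ℝ} (hε : 0 < ε) (hρ : 0 ≤ ρ)
    (hρ₀ : ρ ≤ ρ₀) (hρκ : ρ * √(L / μ - 1) ≤ 1 / 10) {x : Vec d} {m : Fin n → Vec d}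
    (hm : ∀ i k, |m i k| ≤ b) (ha : ∀ i k, (gradient (f i) x k - m i k) ^ 2 ≤ ρ * ε) :
    n * (1 / (2 * √(1 + ρ₀)) * μ * ‖x - xstar‖ ^ 2)
        - n * (d * (‖x - xstar‖
          * ((3 * σ + cstar) * (L * ‖x - xstar‖ + cstar + b) / √ε + b)))
      ≤ ∑ i, ∑ k, (x - xstar) k
        * (√ε * ∫ u, unitClip ε (gradient (f i) x k - m i k + u) ∂ν) := by
  have hs := Real.sqrt_pos.2 hε
  set E := (3 * σ + cstar) * (L * ‖x - xstar‖ + cstar + b) / √ε + b with hE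
  have hterm : ∀ i k,
      shrinkage ε (gradient (f i) x k - m i k)
          * ((x - xstar) k * (gradient (f i) x - gradient (f i) xstar) k)
        + (x - xstar) k * gradient (f i) xstar k - ‖x - xstar‖ * E
      ≤ (x - xstar) k * (√ε * ∫ u, unitClip ε (gradient (f i) x k - m i k + u) ∂ν) := by
    intro i k
    have ha' := abs_gradient_sub_le hμ hμL hf hcstar (x := x) hm i k
    have hg : (gradient (f i) x - gradient (f i) xstar) k
        = gradient (f i) x k - gradient (f i) xstar k := by simp
    rw [hg]
    have hcs := hcstar i k
    have hcs0 : 0 ≤ cstar := (abs_nonneg _).trans hcs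
    set c := gradient (f i) xstar k
    set a := gradient (f i) x k - m i k with hadef
    have h1 := abs_integral_unitClip_add_sub_le hν hε a
    set J := √ε * ∫ u, unitClip ε (a + u) ∂ν
    have h2 := one_sub_shrinkage_le hε a
    have h3 := shrinkage_le_one ε a
    have h3' : 0 ≤ shrinkage ε a := by unfold shrinkage; positivity
    set S := shrinkage ε a
    have hr : |J - S * (gradient (f i) x k - c) - c| ≤ E := by
      have e1 : J - S * (gradient (f i) x k - c) - c
          = (J - S * a) + (-((1 - S) * c) + -(S * m i k)) := by rw [hadef]; ring
      have e2 : |(1 - S) * c| ≤ |a| / √ε * cstar := by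
        rw [abs_mul, abs_of_nonneg (sub_nonneg.2 h3)]
        exact mul_le_mul h2 hcs (abs_nonneg _) (by positivity)
      have e3 : |S * m i k| ≤ b := by
        rw [abs_mul, abs_of_nonneg h3']
        nlinarith [hm i k, abs_nonneg (m i k)]
      have e4 : 3 * σ * |a| / √ε + |a| / √ε * cstar
          ≤ (3 * σ + cstar) * (L * ‖x - xstar‖ + cstar + b) / √ε := by
        calc _ = (3 * σ + cstar) * |a| / √ε := by ring
          _ ≤ _ := by gcongr
      rw [e1]
      refine (abs_add_le _ _).trans ?_
      have e5 := abs_add_le (-((1 - S) * c)) (-(S * m i k))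
      rw [abs_neg, abs_neg] at e5
      linarith
    have h4 : |(x - xstar) k * (J - S * (gradient (f i) x k - c) - c)| ≤ ‖x - xstar‖ * E := by
      rw [abs_mul]
      exact mul_le_mul (abs_apply_le_norm _ k) hr (abs_nonneg _) (norm_nonneg _)
    have h5 := (abs_le.1 h4).1
    linarith
  have hmain : ∀ i, 1 / (2 * √(1 + ρ₀)) * μ * ‖x - xstar‖ ^ 2
      ≤ ∑ k, shrinkage ε (gradient (f i) x k - m i k)
          * ((x - xstar) k * (gradient (f i) x - gradient (f i) xstar) k) := fun i =>
    (hf i).le_sum_shrunk_gradient hμ hμL hρ hρ₀ hρκ x xstar _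
      (fun k => le_shrinkage hε hρ (ha i k)) fun k => shrinkage_le_one ε _
  have hzero : ∑ i, ∑ k, (x - xstar) k * gradient (f i) xstar k = 0 := by
    rw [Finset.sum_comm]
    refine Finset.sum_eq_zero fun k _ => ?_
    have := congrArg (fun y : Vec d => y k) hsum
    rw [← Finset.mul_sum]
    simp only [WithLp.ofLp_sum, Finset.sum_apply, PiLp.zero_apply] at this
    rw [this, mul_zero]
  calc _ ≤ ∑ i, ∑ k, shrinkage ε (gradient (f i) x k - m i k)
          * ((x - xstar) k * (gradient (f i) x - gradient (f i) xstar) k)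
          - n * (d * (‖x - xstar‖ * E)) := by
        have := Finset.card_nsmul_le_sum Finset.univ _ _ fun i _ => hmain i
        simp only [Finset.card_univ, Fintype.card_fin, nsmul_eq_mul] at this
        linarith
    _ = ∑ i, ∑ k, (shrinkage ε (gradient (f i) x k - m i k)
          * ((x - xstar) k * (gradient (f i) x - gradient (f i) xstar) k)
        + (x - xstar) k * gradient (f i) xstar k - ‖x - xstar‖ * E) := by
        simp only [Finset.sum_sub_distrib, Finset.sum_add_distrib, hzero]
        simp
    _ ≤ _ := Finset.sum_le_sum fun i _ => Finset.sum_le_sum fun k _ => hterm i k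

end Drift

/-! ### Averaging over the noise -/

theorem integral_eq_integral_integral_of_indepFun {Ω α β : Type*} [MeasurableSpace Ω]
    [MeasurableSpace α] [MeasurableSpace β] {P : Measure Ω} [IsProbabilityMeasure P] {Y : Ω → α}
    {Z : Ω → β} (hY : Measurable Y) (hZ : Measurable Z) (h : IndepFun Y Z P) {F : α × β → ℝ}
    (hF : Measurable F) (hint : Integrable (fun ω => F (Y ω, Z ω)) P) :
    Integrable (fun ω => ∫ z, F (Y ω, z) ∂(P.map Z)) P ∧
      ∫ ω, F (Y ω, Z ω) ∂P = ∫ ω, ∫ z, F (Y ω, z) ∂(P.map Z) ∂P := by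
  have hYZ : Measurable fun ω => (Y ω, Z ω) := hY.prodMk hZ
  have hmap := (indepFun_iff_map_prod_eq_prod_map_map hY.aemeasurable hZ.aemeasurable).1 h
  have : IsProbabilityMeasure (P.map Z) := Measure.isProbabilityMeasure_map hZ.aemeasurable
  have : IsProbabilityMeasure (P.map Y) := Measure.isProbabilityMeasure_map hY.aemeasurable
  have h1 : Integrable F ((P.map Y).prod (P.map Z)) := by
    rw [← hmap]
    exact (integrable_map_measure hF.aestronglyMeasurable hYZ.aemeasurable).2 hint
  have h2 := h1.integral_prod_left
  refine ⟨(integrable_map_measure h2.aestronglyMeasurable hY.aemeasurable).1 h2, ?_⟩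
  rw [← integral_map hY.aemeasurable (f := fun y => ∫ z, F (y, z) ∂(P.map Z))
      h2.aestronglyMeasurable, ← integral_prod _ h1, ← hmap,
    integral_map hYZ.aemeasurable hF.aestronglyMeasurable]

theorem continuous_smoothClip {d : ℕ} {φ ε : ℝ} (hε : 0 < ε) :
    Continuous (smoothClip φ ε : Vec d → Vec d) := by
  refine (PiLp.continuous_toLp 2 _).comp (continuous_pi fun k => ?_)
  have h : ∀ y : Vec d, √((y k) ^ 2 + ε) ≠ 0 := fun y => by positivity
  exact Continuous.div (by fun_prop) (by fun_prop) h

/-- The state of SClip-EF is measurable for any σ-algebra that makes the past noise measurable; the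
σ-algebra generated by the past noise is such a one. -/
theorem measurable_sclipEF {Ω : Type*} [MeasurableSpace Ω] {n d : ℕ} {θ : ClipParams}
    (hε : ∀ t, 0 < θ.ε t) {f : Fin n → Vec d → ℝ} (hf : ∀ i, Continuous (gradient (f i)))
    {ξ : ℕ → Ω → Fin n → Vec d} (x₀ : Vec d) (t : ℕ) (hξ : ∀ s < t, Measurable (ξ s)) :
    Measurable fun ω => sclipEF θ (noisyGradient f ξ ω) x₀ t := by
  induction t with
  | zero => exact measurable_const
  | succ t ih =>
    have ih := ih fun s hs => hξ s (hs.trans t.lt_succ_self)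
    have hξt : ∀ i, Measurable fun ω => ξ t ω i := fun i =>
      (measurable_pi_apply i).comp (hξ t t.lt_succ_self)
    have hx : Measurable fun ω => (sclipEF θ (noisyGradient f ξ ω) x₀ t).1 := measurable_fst.comp ih
    have hm : ∀ i, Measurable fun ω => (sclipEF θ (noisyGradient f ξ ω) x₀ t).2 i := fun i =>
      (measurable_pi_apply i).comp (measurable_snd.comp ih)
    have hm' : ∀ i, Measurable fun ω => (sclipEF θ (noisyGradient f ξ ω) x₀ (t + 1)).2 i := fun i => by
      have h1 : Measurable fun ω => noisyGradient f ξ ω t i (sclipEF θ (noisyGradient f ξ ω) x₀ t).1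
          - (sclipEF θ (noisyGradient f ξ ω) x₀ t).2 i :=
        (((hf i).measurable.comp hx).add (hξt i)).sub (hm i)
      exact ((hm i).const_smul (θ.β t)).add
        (((continuous_smoothClip (hε t)).measurable.comp h1).const_smul (1 - θ.β t))
    refine Measurable.prodMk ?_ (measurable_pi_lambda _ hm')
    exact hx.sub ((Finset.measurable_fun_sum _ fun i _ => hm' i).const_smul (θ.η t / (n : ℝ)))

/-- The state at iteration `t` depends only on the noise before `t`. -/
theorem GradientNoise.indepFun_sclipEF {Ω : Type*} [MeasurableSpace Ω] {P : Measure Ω} {n d : ℕ}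
    {p : ℝ → ℝ} {ξ : ℕ → Ω → Fin n → Vec d} (hξ : GradientNoise P p ξ) {θ : ClipParams}
    (hε : ∀ t, 0 < θ.ε t) {f : Fin n → Vec d → ℝ} (hf : ∀ i, Continuous (gradient (f i)))
    (x₀ : Vec d) (t : ℕ) :
    IndepFun (fun ω => sclipEF θ (noisyGradient f ξ ω) x₀ t) (ξ t) P := by
  have h1 := indep_iSup_of_disjoint (fun s => (hξ.measurable s).comap_le) hξ.indep
    (S := Set.Iio t) (T := {t}) (by simp)
  refine indep_of_indep_of_le_left (indep_of_indep_of_le_right h1 ?_) ?_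
  · simp
  · refine Measurable.comap_le ?_
    refine @measurable_sclipEF Ω (⨆ s ∈ Set.Iio t, MeasurableSpace.comap (ξ s) inferInstance) n d θ
      hε f hf ξ x₀ t fun s hs => ?_
    exact Measurable.mono (comap_measurable (ξ s))
      (le_iSup₂_of_le (f := fun s (_ : s ∈ Set.Iio t) => MeasurableSpace.comap (ξ s) inferInstance)
        s hs le_rfl) le_rfl

theorem GradientNoise.integral_inner_eq_integral_meanDrift {Ω : Type*} [MeasurableSpace Ω]
    {P : Measure Ω} [IsProbabilityMeasure P] {n d : ℕ} {p : ℝ → ℝ} {ξ : ℕ → Ω → Fin n → Vec d}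
    (hξ : GradientNoise P p ξ) {θ : ClipParams} (hε : ∀ t, 0 < θ.ε t) {f : Fin n → Vec d → ℝ}
    (hf : ∀ i, Continuous (gradient (f i))) (x₀ xstar : Vec d) (t : ℕ)
    (hint : Integrable (fun ω => inner ℝ ((sclipEF θ (noisyGradient f ξ ω) x₀ t).1 - xstar)
      (∑ i, (sclipEF θ (noisyGradient f ξ ω) x₀ (t + 1)).2 i)) P) :
    Integrable (fun ω => meanDrift θ f xstar (volume.withDensity fun u => ENNReal.ofReal (p u)) t
      (sclipEF θ (noisyGradient f ξ ω) x₀ t)) P ∧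
    ∫ ω, inner ℝ ((sclipEF θ (noisyGradient f ξ ω) x₀ t).1 - xstar)
        (∑ i, (sclipEF θ (noisyGradient f ξ ω) x₀ (t + 1)).2 i) ∂P
      = ∫ ω, meanDrift θ f xstar (volume.withDensity fun u => ENNReal.ofReal (p u)) t
        (sclipEF θ (noisyGradient f ξ ω) x₀ t) ∂P := by
  let F : (Vec d × (Fin n → Vec d)) × (Fin n → Vec d) → ℝ := fun y =>
    ∑ i, ∑ k, (y.1.1 - xstar) k * (θ.β t * y.1.2 i k + (1 - θ.β t) * (θ.φ t *
      unitClip (θ.ε t) (gradient (f i) y.1.1 k - y.1.2 i k + y.2 i k)))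
  have hcoord : ∀ k : Fin d, Measurable fun x : Vec d => x k := fun k =>
    (by fun_prop : Continuous fun x : Vec d => x k).measurable
  have hF : Measurable F := by
    refine Finset.measurable_fun_sum _ fun i _ => Finset.measurable_fun_sum _ fun k _ => ?_
    have h1 : Measurable fun y : (Vec d × (Fin n → Vec d)) × (Fin n → Vec d) => y.1.1 :=
      measurable_fst.comp measurable_fst
    have h2 : Measurable fun y : (Vec d × (Fin n → Vec d)) × (Fin n → Vec d) => y.1.2 i k :=
      (hcoord k).comp ((measurable_pi_apply i).comp (measurable_snd.comp measurable_fst))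
    have h3 : Measurable fun y : (Vec d × (Fin n → Vec d)) × (Fin n → Vec d) => y.2 i k :=
      (hcoord k).comp ((measurable_pi_apply i).comp measurable_snd)
    have h4 := (hcoord k).comp ((hf i).measurable.comp h1)
    have h5 := (continuous_unitClip (hε t)).measurable.comp ((h4.sub h2).add h3)
    exact ((hcoord k).comp (h1.sub_const xstar)).mul
      ((h2.const_mul _).add ((h5.const_mul _).const_mul _))
  have hFeq : ∀ ω, inner ℝ ((sclipEF θ (noisyGradient f ξ ω) x₀ t).1 - xstar)
      (∑ i, (sclipEF θ (noisyGradient f ξ ω) x₀ (t + 1)).2 i)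
      = F (sclipEF θ (noisyGradient f ξ ω) x₀ t, ξ t ω) := fun ω => by
    simp only [F]
    rw [inner_sum]
    refine Finset.sum_congr rfl fun i _ => ?_
    have h1 : (sclipEF θ (noisyGradient f ξ ω) x₀ (t + 1)).2 i
        = feedback θ t ((sclipEF θ (noisyGradient f ξ ω) x₀ t).2 i)
          (gradient (f i) (sclipEF θ (noisyGradient f ξ ω) x₀ t).1 + ξ t ω i) := rfl
    rw [h1, PiLp.inner_apply]
    refine Finset.sum_congr rfl fun k _ => ?_
    rw [feedback_apply, PiLp.add_apply, add_sub_right_comm, RCLike.inner_apply, conj_trivial, mul_comm]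
  have hmean : ∀ s, ∫ z, F (s, z) ∂(P.map (ξ t))
      = meanDrift θ f xstar (volume.withDensity fun u => ENNReal.ofReal (p u)) t s := fun s => by
    have : IsProbabilityMeasure (P.map (ξ t)) :=
      Measure.isProbabilityMeasure_map (hξ.measurable t).aemeasurable
    have hz : ∀ i k, Measurable fun z : Fin n → Vec d => z i k := fun i k =>
      (hcoord k).comp (measurable_pi_apply i)
    have hi : ∀ i k (a : ℝ), Integrable (fun z : Fin n → Vec d => unitClip (θ.ε t) (a + z i k))
        (P.map (ξ t)) := fun i k a =>
      Integrable.of_bound ((continuous_unitClip (hε t)).measurable.comp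
        ((hz i k).const_add a)).aestronglyMeasurable 1
        (ae_of_all _ fun z => abs_unitClip_le_one (hε t).le _)
    have hI : ∀ i k (a : ℝ), ∫ z : Fin n → Vec d, unitClip (θ.ε t) (a + z i k) ∂(P.map (ξ t))
        = ∫ u, unitClip (θ.ε t) (a + u) ∂(volume.withDensity fun u => ENNReal.ofReal (p u)) :=
      fun i k a => by
        rw [← hξ.density t i k]
        change _ = ∫ u, _ ∂(P.map ((fun z : Fin n → Vec d => z i k) ∘ ξ t))
        rw [← Measure.map_map (hz i k) (hξ.measurable t)]
        exact (integral_map (hz i k).aemeasurable (((continuous_unitClip (hε t)).measurable.comp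
          (measurable_const_add a)).aestronglyMeasurable)).symm
    have hterm : ∀ i k, Integrable (fun z : Fin n → Vec d => (s.1 - xstar) k * (θ.β t * s.2 i k
        + (1 - θ.β t) * (θ.φ t *
          unitClip (θ.ε t) (gradient (f i) s.1 k - s.2 i k + z i k)))) (P.map (ξ t)) := fun i k =>
      ((integrable_const _).add (((hi i k _).const_mul _).const_mul _)).const_mul _
    simp only [F]
    rw [integral_finsetSum _ fun i _ => integrable_finsetSum _ fun k _ => hterm i k]
    refine Finset.sum_congr rfl fun i _ => ?_
    rw [integral_finsetSum _ fun k _ => hterm i k]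
    refine Finset.sum_congr rfl fun k _ => ?_
    rw [integral_const_mul, integral_add (integrable_const _)
      (((hi i k _).const_mul _).const_mul _), integral_const_mul, integral_const_mul, integral_const_mul,
      hI]
    simp
  have hY := measurable_sclipEF hε hf x₀ t fun s _ => hξ.measurable s
  simp only [hFeq] at hint ⊢
  have := integral_eq_integral_integral_of_indepFun hY (hξ.measurable t)
    (hξ.indepFun_sclipEF hε hf x₀ t) hF hint
  simpa only [hmean] using this

/-! ### The one-step recursion -/

theorem tendsto_natCast_add_one_rpow_neg {r : ℝ} (hr : 0 < r) :
    Tendsto (fun t : ℕ => ((t : ℝ) + 1) ^ (-r)) atTop (𝓝 0) :=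
  (tendsto_rpow_neg_atTop hr).comp
    ((tendsto_natCast_atTop_atTop (R := ℝ)).atTop_add (tendsto_const_nhds (x := (1 : ℝ))))

theorem eventually_sq_add_mul_rpow_le {C G τ : ℝ} (hC : 0 ≤ C) (hG : 0 < G) (hτ : 0 < τ) :
    ∀ᶠ t : ℕ in atTop, (C + G * ((t : ℝ) + 1) ^ (3 / 10 : ℝ)) ^ 2
      ≤ 11 / 10 * (G ^ 2 / τ) * (τ * ((t : ℝ) + 1) ^ (3 / 5 : ℝ)) := by
  have h := (tendsto_natCast_add_one_rpow_neg (r := 3 / 10) (by norm_num)).const_mul C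
  rw [mul_zero] at h
  filter_upwards [h.eventually_le_const (show 0 < G / 25 by positivity)] with t ht
  have hT : (0 : ℝ) < (t : ℝ) + 1 := by positivity
  have h1 : ((t : ℝ) + 1) ^ (3 / 5 : ℝ) = (((t : ℝ) + 1) ^ (3 / 10 : ℝ)) ^ 2 := by
    rw [← Real.rpow_natCast, ← Real.rpow_mul hT.le]; norm_num
  rw [Real.rpow_neg hT.le, ← div_eq_mul_inv, div_le_iff₀ (by positivity)] at ht
  have hX : 0 < ((t : ℝ) + 1) ^ (3 / 10 : ℝ) := by positivity
  rw [h1]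
  set X := ((t : ℝ) + 1) ^ (3 / 10 : ℝ)
  have h2 : 11 / 10 * (G ^ 2 / τ) * (τ * X ^ 2) = 11 / 10 * (G * X) ^ 2 := by
    field_simp
  rw [h2]
  have h3 : C + G * X ≤ 26 / 25 * (G * X) := by linarith
  have h4 := pow_le_pow_left₀ (by positivity) h3 2
  have h5 : 0 ≤ (G * X) ^ 2 := by positivity
  rw [mul_pow] at h4
  linarith

/-- Young's inequality absorbs the terms that are linear in `V`; the rate drops from `2 q` to `q`. -/
theorem eventually_drift_le {q A B cβ : ℝ} (hq : 0 < q) (hB : 0 ≤ B) (hcβ : 0 ≤ cβ) :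
    ∀ᶠ t : ℕ in atTop, ∀ V : ℝ, 0 ≤ V →
      V ^ 2 + A * V * ((t : ℝ) + 1) ^ (-(6 / 5) : ℝ)
        - 2 * (1 - cβ / √((t : ℝ) + 1)) / ((t : ℝ) + 1)
          * (q * V ^ 2 - B * (V ^ 2 + V) * ((t : ℝ) + 1) ^ (-(3 / 10) : ℝ))
      ≤ (1 - q / ((t : ℝ) + 1)) * V ^ 2
        + (A + 2 * B) ^ 2 / (2 * q) * ((t : ℝ) + 1) ^ (-(7 / 5) : ℝ) := by
  have h1 := (tendsto_natCast_add_one_rpow_neg (r := 1 / 2) (by norm_num)).const_mul cβ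
  have h2 := (tendsto_natCast_add_one_rpow_neg (r := 3 / 10) (by norm_num)).const_mul (2 * B)
  rw [mul_zero] at h1 h2
  filter_upwards [h1.eventually_le_const (show (0 : ℝ) < 1 / 8 by norm_num),
    h2.eventually_le_const (show 0 < q / 4 by positivity)] with t h1 h2 V hV
  have hT : (0 : ℝ) < (t : ℝ) + 1 := by positivity
  have hT1 : (1 : ℝ) ≤ (t : ℝ) + 1 := by linarith [t.cast_nonneg (α := ℝ)]
  rw [Real.rpow_neg hT.le, ← Real.sqrt_eq_rpow, ← div_eq_mul_inv] at h1
  have e3 : ((t : ℝ) + 1) ^ (-(3 / 10) : ℝ) / ((t : ℝ) + 1) ≤ ((t : ℝ) + 1) ^ (-(6 / 5) : ℝ) := by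
    rw [← Real.rpow_sub_one hT.ne']
    exact Real.rpow_le_rpow_of_exponent_le hT1 (by norm_num)
  have e4 : (((t : ℝ) + 1) ^ (-(7 / 10) : ℝ)) ^ 2 = ((t : ℝ) + 1) ^ (-(7 / 5) : ℝ) := by
    rw [← Real.rpow_natCast, ← Real.rpow_mul hT.le]; norm_num
  have e5 : ((t : ℝ) + 1) ^ (-(1 / 2) : ℝ) * ((t : ℝ) + 1) ^ (-(7 / 10) : ℝ)
      = ((t : ℝ) + 1) ^ (-(6 / 5) : ℝ) := by
    rw [← Real.rpow_add hT]; norm_num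
  have e6 : (((t : ℝ) + 1) ^ (-(1 / 2) : ℝ)) ^ 2 = 1 / ((t : ℝ) + 1) := by
    rw [← Real.rpow_natCast, ← Real.rpow_mul hT.le,
      show (-(1 / 2) : ℝ) * ((2 : ℕ) : ℝ) = -1 by norm_num, Real.rpow_neg_one, one_div]
  have hβ0 : 0 ≤ cβ / √((t : ℝ) + 1) := by positivity
  have hY : 0 ≤ ((t : ℝ) + 1) ^ (-(3 / 10) : ℝ) := by positivity
  have hU : 0 < 1 / ((t : ℝ) + 1) := by positivity
  have hW : 0 ≤ ((t : ℝ) + 1) ^ (-(6 / 5) : ℝ) := by positivity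
  -- Young's inequality for `V (t+1)^(-1/2)` and `(t+1)^(-7/10)`
  have hyoung : (A + 2 * B) * V * ((t : ℝ) + 1) ^ (-(6 / 5) : ℝ)
      ≤ q / 2 * (V ^ 2 * (1 / ((t : ℝ) + 1)))
        + (A + 2 * B) ^ 2 / (2 * q) * ((t : ℝ) + 1) ^ (-(7 / 5) : ℝ) := by
    rw [← e4, ← e5, ← e6]
    set X := ((t : ℝ) + 1) ^ (-(1 / 2) : ℝ)
    set Z := ((t : ℝ) + 1) ^ (-(7 / 10) : ℝ)
    have h := sq_nonneg (q * (V * X) - (A + 2 * B) * Z)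
    have h' : 0 ≤ (q * (V * X) - (A + 2 * B) * Z) ^ 2 / (2 * q) := by positivity
    have e : (q * (V * X) - (A + 2 * B) * Z) ^ 2 / (2 * q)
        = q / 2 * (V ^ 2 * X ^ 2) + (A + 2 * B) ^ 2 / (2 * q) * Z ^ 2
          - (A + 2 * B) * V * (X * Z) := by
      field_simp
      ring
    linarith
  set β := cβ / √((t : ℝ) + 1)
  rw [div_eq_mul_one_div] at e3
  rw [div_eq_mul_one_div (2 * (1 - β)), div_eq_mul_one_div q]
  set U := 1 / ((t : ℝ) + 1)
  set Y := ((t : ℝ) + 1) ^ (-(3 / 10) : ℝ)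
  set W := ((t : ℝ) + 1) ^ (-(6 / 5) : ℝ)
  have t1 : 7 / 4 * (q * V ^ 2 * U) ≤ 2 * (1 - β) * (q * V ^ 2 * U) :=
    mul_le_mul_of_nonneg_right (by linarith) (by positivity)
  have t2 : 2 * (1 - β) * (B * V ^ 2 * Y * U) ≤ q / 4 * (V ^ 2 * U) := by
    calc _ ≤ 2 * (B * V ^ 2 * Y * U) :=
          mul_le_mul_of_nonneg_right (by linarith) (by positivity)
      _ = 2 * B * Y * (V ^ 2 * U) := by ring
      _ ≤ _ := mul_le_mul_of_nonneg_right h2 (by positivity)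
  have t3 : 2 * (1 - β) * (B * V * (Y * U)) ≤ 2 * (B * V * W) := by
    calc _ ≤ 2 * (B * V * (Y * U)) :=
          mul_le_mul_of_nonneg_right (by linarith) (by positivity)
      _ ≤ _ := by gcongr
  linarith

/-- The constant `c` of the eventual contraction factor `1 - c / (t + 1)`: the effective step size
`cη cφ / √τ` times the modulus of strong convexity that survives clipping. -/
noncomputable def contractionRate (μ cφ τ cη ρ₀ : ℝ) : ℝ :=
  cη * cφ / √τ * (1 / (2 * √(1 + ρ₀)) * μ)

namespace ScheduleConstants

variable {cφ τ cβ cη : ℝ} {n d : ℕ} {μ L σ cstar : ℝ} {f : Fin n → Vec d → ℝ} {xstar : Vec d}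
  {ν : Measure ℝ}

/-- Eventually the clipped arguments are at most a fixed multiple of `√ε t`. The constant `110 / 9`
is `(10 / 3) ^ 2`, from the growth of the iterates, with a margin of one tenth. -/
theorem eventually_sq_gradient_sub_le (hc : ScheduleConstants cφ τ cβ cη) (hd : 0 < d)
    (hμ : 0 < μ) (hμL : μ ≤ L) (hf : ∀ i, HessianBounds μ L (f i)) (hcs : 0 ≤ cstar)
    (hcstar : ∀ i k, |gradient (f i) xstar k| ≤ cstar) (x₀ : Vec d) :
    ∀ᶠ t : ℕ in atTop, ∀ (g : ℕ → Fin n → Vec d → Vec d) (i : Fin n) (k : Fin d),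
      (gradient (f i) (sclipEF (schedule cφ τ cβ cη) g x₀ t).1 k
          - (sclipEF (schedule cφ τ cβ cη) g x₀ t).2 i k) ^ 2
        ≤ 110 / 9 * (cη ^ 2 * cφ ^ 2 * d * L ^ 2 / τ) * (schedule cφ τ cβ cη).ε t := by
  have hφ := hc.φ_pos
  have hη := hc.η_pos
  have hL : 0 < L := hμ.trans_le hμL
  have hd' : (0 : ℝ) < d := by exact_mod_cast hd
  obtain ⟨R, hR, hbound⟩ := hc.exists_norm_sub_le (n := n) x₀ xstar
  filter_upwards [eventually_sq_add_mul_rpow_le (C := L * R + cstar + cφ)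
    (G := L * (10 / 3 * (√d * cη * cφ))) (by positivity) (by positivity) hc.τ_pos] with t ht g i k
  have h1 := abs_gradient_sub_le hμ hμL hf hcstar
    (x := (sclipEF (schedule cφ τ cβ cη) g x₀ t).1) (hc.abs_estimator_le g x₀ t) i k
  have h2 := mul_le_mul_of_nonneg_left (hbound g t) hL.le
  have h3 := pow_le_pow_left₀ (abs_nonneg _) (h1.trans (b := L *
    ‖(sclipEF (schedule cφ τ cβ cη) g x₀ t).1 - xstar‖ + cstar + cφ)
    (c := L * R + cstar + cφ + L * (10 / 3 * (√d * cη * cφ)) * ((t : ℝ) + 1) ^ (3 / 10 : ℝ))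
    (by linarith)) 2
  rw [sq_abs] at h3
  refine (h3.trans ht).trans (le_of_eq ?_)
  have h4 : (L * (10 / 3 * (√d * cη * cφ))) ^ 2 = 100 / 9 * (cη ^ 2 * cφ ^ 2 * d * L ^ 2) := by
    rw [mul_pow, mul_pow, mul_pow, mul_pow, Real.sq_sqrt hd'.le]; ring
  rw [h4]
  simp only [schedule]
  ring

/-- The mean drift, computed pathwise, contracts the squared distance to the minimizer. -/
theorem eventually_norm_sq_sub_meanDrift_le [IsProbabilityMeasure ν] (hν : IsSymmetricNoise σ ν)
    (hc : ScheduleConstants cφ τ cβ cη) (hn : 0 < n) (hd : 0 < d) (hσ : 0 ≤ σ)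
    (hμ : 0 < μ) (hμL : μ ≤ L) (hf : ∀ i, HessianBounds μ L (f i))
    (hsum : ∑ i, gradient (f i) xstar = 0) (hcs : 0 ≤ cstar)
    (hcstar : ∀ i k, |gradient (f i) xstar k| ≤ cstar) {ρ₀ : ℝ}
    (hρ₀ : 110 / 9 * (cη ^ 2 * cφ ^ 2 * d * L ^ 2 / τ) ≤ ρ₀)
    (hρκ : 110 / 9 * (cη ^ 2 * cφ ^ 2 * d * L ^ 2 / τ) * √(L / μ - 1) ≤ 1 / 10) (x₀ : Vec d) :
    ∃ C, ∀ᶠ t : ℕ in atTop, ∀ g : ℕ → Fin n → Vec d → Vec d,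
      ‖(sclipEF (schedule cφ τ cβ cη) g x₀ t).1 - xstar‖ ^ 2
        - 2 * ((schedule cφ τ cβ cη).η t / n) * meanDrift (schedule cφ τ cβ cη) f xstar ν t
          (sclipEF (schedule cφ τ cβ cη) g x₀ t)
      ≤ (1 - contractionRate μ cφ τ cη ρ₀ / ((t : ℝ) + 1))
          * ‖(sclipEF (schedule cφ τ cβ cη) g x₀ t).1 - xstar‖ ^ 2
        + C * ((t : ℝ) + 1) ^ (-(7 / 5) : ℝ) := by
  have hφ := hc.φ_pos
  have hη := hc.η_pos
  have hτ := hc.τ_pos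
  have hβ := hc.β_nonneg
  have hL : 0 < L := hμ.trans_le hμL
  have hn' : (0 : ℝ) < n := by exact_mod_cast hn
  have hρ : 0 ≤ 110 / 9 * (cη ^ 2 * cφ ^ 2 * d * L ^ 2 / τ) := by positivity
  have hρ₀' := hρ.trans hρ₀
  obtain ⟨B', hB'⟩ : ∃ B', B' = (3 * σ + cstar) * (L + cstar + 4 * cφ) / √τ + 4 * cφ := ⟨_, rfl⟩
  have hB'0 : 0 ≤ B' := by rw [hB']; positivity
  refine ⟨(8 * d * cη * cβ * cφ + 2 * (cη * cφ / √τ * (d * B'))) ^ 2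
    / (2 * contractionRate μ cφ τ cη ρ₀), ?_⟩
  filter_upwards [hc.eventually_sq_gradient_sub_le hd hμ hμL hf hcs hcstar x₀,
    eventually_drift_le (q := contractionRate μ cφ τ cη ρ₀) (A := 8 * d * cη * cβ * cφ)
      (B := cη * cφ / √τ * (d * B')) (cβ := cβ) (by unfold contractionRate; positivity)
      (by positivity) hβ] with t hsq hdrift g
  refine le_trans ?_ (hdrift _ (norm_nonneg _))
  have hT : (0 : ℝ) < (t : ℝ) + 1 := by positivity
  have hT1 : (1 : ℝ) ≤ (t : ℝ) + 1 := by linarith [t.cast_nonneg (α := ℝ)]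
  have hest := hc.abs_estimator_le_div_sqrt g x₀ t
  have hmain := le_sum_mul_integral_unitClip hν hσ hμ hμL hf hsum hcstar (hc.ε_pos t) hρ hρ₀ hρκ
    hest (hsq g)
  have hβ0 := hc.schedule_β_nonneg t
  have hβ1 := hc.schedule_β_le_one t
  have hsε := hc.sqrt_ε t
  obtain ⟨m, hm⟩ : ∃ m, m = (sclipEF (schedule cφ τ cβ cη) g x₀ t).2 := ⟨_, rfl⟩
  obtain ⟨x, hx⟩ : ∃ x, x = (sclipEF (schedule cφ τ cβ cη) g x₀ t).1 := ⟨_, rfl⟩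
  simp only [meanDrift]
  rw [← hx, ← hm] at hmain ⊢
  rw [← hm] at hest
  have hV : 0 ≤ ‖x - xstar‖ := norm_nonneg _
  have hr3 : 0 < ((t : ℝ) + 1) ^ (3 / 10 : ℝ) := by positivity
  have hsq0 : √((t : ℝ) + 1) = ((t : ℝ) + 1) ^ (1 / 2 : ℝ) := Real.sqrt_eq_rpow _
  -- the error feedback terms
  have hfb : -(n * (d * (‖x - xstar‖ * (4 * cφ / √((t : ℝ) + 1)))))
      ≤ ∑ i, ∑ k, (x - xstar) k * m i k := by
    have : ∀ i k, -(‖x - xstar‖ * (4 * cφ / √((t : ℝ) + 1))) ≤ (x - xstar) k * m i k :=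
      fun i k => by
        refine (abs_le.1 ?_).1
        rw [abs_mul]
        exact mul_le_mul (abs_apply_le_norm _ k) (hest i k) (abs_nonneg _) hV
    calc _ = ∑ _i : Fin n, ∑ _k : Fin d, -(‖x - xstar‖ * (4 * cφ / √((t : ℝ) + 1))) := by simp
      _ ≤ _ := Finset.sum_le_sum fun i _ => Finset.sum_le_sum fun k _ => this i k
  -- the error in the clipped terms
  have herr : ‖x - xstar‖ * ((3 * σ + cstar)
      * (L * ‖x - xstar‖ + cstar + 4 * cφ / √((t : ℝ) + 1)) / √((schedule cφ τ cβ cη).ε t)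
        + 4 * cφ / √((t : ℝ) + 1))
      ≤ B' * (‖x - xstar‖ ^ 2 + ‖x - xstar‖) * ((t : ℝ) + 1) ^ (-(3 / 10) : ℝ) := by
    have h1 : 4 * cφ / √((t : ℝ) + 1) ≤ 4 * cφ :=
      div_le_self (by positivity) (Real.one_le_sqrt.2 hT1)
    have h2 : 4 * cφ / √((t : ℝ) + 1) ≤ 4 * cφ * ((t : ℝ) + 1) ^ (-(3 / 10) : ℝ) := by
      rw [hsq0, div_eq_mul_inv, ← Real.rpow_neg hT.le]
      exact mul_le_mul_of_nonneg_left
        (Real.rpow_le_rpow_of_exponent_le hT1 (by norm_num)) (by positivity)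
    have h3 : (3 * σ + cstar) * (L * ‖x - xstar‖ + cstar + 4 * cφ / √((t : ℝ) + 1))
        / √((schedule cφ τ cβ cη).ε t)
        ≤ (3 * σ + cstar) * (L + cstar + 4 * cφ) / √τ * (‖x - xstar‖ + 1)
          * ((t : ℝ) + 1) ^ (-(3 / 10) : ℝ) := by
      rw [hsε, Real.rpow_neg hT.le]
      calc _ ≤ (3 * σ + cstar) * ((L + cstar + 4 * cφ) * (‖x - xstar‖ + 1))
            / (√τ * ((t : ℝ) + 1) ^ (3 / 10 : ℝ)) := by
            gcongr
            nlinarith [mul_nonneg (add_nonneg hcs hφ.le) hV, mul_nonneg hφ.le hV]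
        _ = _ := by field_simp
    have hY : 0 ≤ ((t : ℝ) + 1) ^ (-(3 / 10) : ℝ) := by positivity
    calc _ ≤ ‖x - xstar‖ * (B' * (‖x - xstar‖ + 1) * ((t : ℝ) + 1) ^ (-(3 / 10) : ℝ)) := by
          refine mul_le_mul_of_nonneg_left ?_ hV
          rw [hB']
          have : 0 ≤ 4 * cφ * ‖x - xstar‖ * ((t : ℝ) + 1) ^ (-(3 / 10) : ℝ) := by positivity
          linarith
      _ = _ := by ring
  have hηφ : (schedule cφ τ cβ cη).η t * (schedule cφ τ cβ cη).φ t
      / √((schedule cφ τ cβ cη).ε t) = cη * cφ / √τ / ((t : ℝ) + 1) := by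
    rw [hsε]
    simp only [schedule]
    have : (t : ℝ) + 1 = ((t : ℝ) + 1) ^ (1 / 5 : ℝ) * ((t : ℝ) + 1) ^ (1 / 2 : ℝ)
        * ((t : ℝ) + 1) ^ (3 / 10 : ℝ) := by
      rw [← Real.rpow_add hT, ← Real.rpow_add hT]; norm_num
    rw [hsq0]
    nth_rw 4 [this]
    field_simp
  have hηβ : 2 * (schedule cφ τ cβ cη).η t * (schedule cφ τ cβ cη).β t
      * (d * (‖x - xstar‖ * (4 * cφ / √((t : ℝ) + 1))))
      = 8 * d * cη * cβ * cφ * ‖x - xstar‖ * ((t : ℝ) + 1) ^ (-(6 / 5) : ℝ) := by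
    simp only [schedule]
    have : ((t : ℝ) + 1) ^ (-(6 / 5) : ℝ) = (((t : ℝ) + 1) ^ (1 / 5 : ℝ)
        * ((t : ℝ) + 1) ^ (1 / 2 : ℝ) * ((t : ℝ) + 1) ^ (1 / 2 : ℝ))⁻¹ := by
      rw [← Real.rpow_add hT, ← Real.rpow_add hT, ← Real.rpow_neg hT.le]; norm_num
    rw [this, hsq0]
    field_simp
    ring
  have hsplit : ∑ i, ∑ k, (x - xstar) k * ((schedule cφ τ cβ cη).β t * m i k
        + (1 - (schedule cφ τ cβ cη).β t) * ((schedule cφ τ cβ cη).φ t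
          * ∫ u, unitClip ((schedule cφ τ cβ cη).ε t) (gradient (f i) x k - m i k + u) ∂ν))
      = (schedule cφ τ cβ cη).β t * ∑ i, ∑ k, (x - xstar) k * m i k
        + (1 - (schedule cφ τ cβ cη).β t) * ((schedule cφ τ cβ cη).φ t
            / √((schedule cφ τ cβ cη).ε t))
          * ∑ i, ∑ k, (x - xstar) k * (√((schedule cφ τ cβ cη).ε t)
            * ∫ u, unitClip ((schedule cφ τ cβ cη).ε t) (gradient (f i) x k - m i k + u) ∂ν) := by
    simp only [Finset.mul_sum, ← Finset.sum_add_distrib]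
    refine Finset.sum_congr rfl fun i _ => Finset.sum_congr rfl fun k _ => ?_
    have := (Real.sqrt_pos.2 (hc.ε_pos t)).ne'
    field_simp
  rw [hsplit]
  have hη0 : 0 ≤ (schedule cφ τ cβ cη).η t := hc.schedule_η_nonneg t
  have hφ0 : 0 ≤ (schedule cφ τ cβ cη).φ t := hc.schedule_φ_nonneg t
  have hβeq : cβ / √((t : ℝ) + 1) = (schedule cφ τ cβ cη).β t := rfl
  rw [hβeq, ← hηβ]
  set b := 4 * cφ / √((t : ℝ) + 1)
  set β := (schedule cφ τ cβ cη).β t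
  set η := (schedule cφ τ cβ cη).η t
  set φ := (schedule cφ τ cβ cη).φ t
  set sε := √((schedule cφ τ cβ cη).ε t)
  set V := ‖x - xstar‖
  set M := ∑ i, ∑ k, (x - xstar) k * m i k
  set H := ∑ i, ∑ k, (x - xstar) k * (sε
    * ∫ u, unitClip ((schedule cφ τ cβ cη).ε t) (gradient (f i) x k - m i k + u) ∂ν)
  set Y := ((t : ℝ) + 1) ^ (-(3 / 10) : ℝ)
  have hγ : 0 ≤ η * φ / sε := by rw [hηφ]; positivity
  have k1 : -(2 * η * β * (d * (V * b))) ≤ 2 * (η / n) * (β * M) := by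
    have := mul_le_mul_of_nonneg_left hfb (show 0 ≤ 2 * (η / n) * β by positivity)
    calc _ = 2 * (η / n) * β * -(n * (d * (V * b))) := by field_simp
      _ ≤ _ := by linarith
  have k2 : n * (1 / (2 * √(1 + ρ₀)) * μ * V ^ 2 - d * (B' * (V ^ 2 + V) * Y)) ≤ H := by
    have := mul_le_mul_of_nonneg_left herr (show (0 : ℝ) ≤ n * d by positivity)
    refine le_trans ?_ hmain
    linarith
  have k3 : 2 * (1 - β) / ((t : ℝ) + 1) * (contractionRate μ cφ τ cη ρ₀ * V ^ 2
      - cη * cφ / √τ * (d * B') * (V ^ 2 + V) * Y)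
      ≤ 2 * (η / n) * ((1 - β) * (φ / sε) * H) := by
    have h := mul_le_mul_of_nonneg_left k2
      (show 0 ≤ 2 * (1 - β) * (η * φ / sε) / n from
        div_nonneg (mul_nonneg (by linarith) hγ) hn'.le)
    calc _ = 2 * (1 - β) * (η * φ / sε) / n
          * (n * (1 / (2 * √(1 + ρ₀)) * μ * V ^ 2 - d * (B' * (V ^ 2 + V) * Y))) := by
          rw [hηφ, contractionRate]
          field_simp
      _ ≤ _ := h
      _ = _ := by ring
  linarith

end ScheduleConstants

/-! ### Convergence of the mean square error -/

section MeanSquare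

variable {cφ τ cβ cη : ℝ} {n d : ℕ} {f : Fin n → Vec d → ℝ} {Ω : Type*} [MeasurableSpace Ω]
  {P : Measure Ω} [IsProbabilityMeasure P] {p : ℝ → ℝ} {ξ : ℕ → Ω → Fin n → Vec d}

theorem integrable_norm_sub_sq (hc : ScheduleConstants cφ τ cβ cη)
    (hf : ∀ i, Continuous (gradient (f i))) (hξ : GradientNoise P p ξ) (x₀ xstar : Vec d) (t : ℕ) :
    Integrable (fun ω =>
      ‖(sclipEF (schedule cφ τ cβ cη) (noisyGradient f ξ ω) x₀ t).1 - xstar‖ ^ 2) P := by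
  obtain ⟨R, -, hR⟩ := hc.exists_norm_sub_le (n := n) x₀ xstar
  have h := measurable_sclipEF hc.ε_pos hf x₀ t fun s _ => hξ.measurable s
  refine Integrable.of_bound
    (((measurable_fst.comp h).sub_const xstar).norm.pow_const 2).aestronglyMeasurable
    ((R + 10 / 3 * (√d * cη * cφ) * ((t : ℝ) + 1) ^ (3 / 10 : ℝ)) ^ 2) (ae_of_all _ fun ω => ?_)
  rw [norm_pow, norm_norm]
  exact pow_le_pow_left₀ (norm_nonneg _) (hR _ t) 2

theorem integral_norm_sub_sq_succ_le (hc : ScheduleConstants cφ τ cβ cη)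
    (hf : ∀ i, Continuous (gradient (f i))) (hξ : GradientNoise P p ξ) (x₀ xstar : Vec d) (t : ℕ) :
    Integrable (fun ω => meanDrift (schedule cφ τ cβ cη) f xstar
      (volume.withDensity fun u => ENNReal.ofReal (p u)) t
      (sclipEF (schedule cφ τ cβ cη) (noisyGradient f ξ ω) x₀ t)) P ∧
    ∫ ω, ‖(sclipEF (schedule cφ τ cβ cη) (noisyGradient f ξ ω) x₀ (t + 1)).1 - xstar‖ ^ 2 ∂P
      ≤ ∫ ω, ‖(sclipEF (schedule cφ τ cβ cη) (noisyGradient f ξ ω) x₀ t).1 - xstar‖ ^ 2 ∂P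
        - 2 * ((schedule cφ τ cβ cη).η t / n) * ∫ ω, meanDrift (schedule cφ τ cβ cη) f xstar
          (volume.withDensity fun u => ENNReal.ofReal (p u)) t
          (sclipEF (schedule cφ τ cβ cη) (noisyGradient f ξ ω) x₀ t) ∂P
        + 25 * (√d * cη * cφ) ^ 2 * ((t : ℝ) + 1) ^ (-(7 / 5) : ℝ) := by
  have hT : (0 : ℝ) < (t : ℝ) + 1 := by positivity
  have hφ := hc.φ_pos
  have hη := hc.η_pos
  have hmeas : ∀ t, Measurable fun ω =>
      sclipEF (schedule cφ τ cβ cη) (noisyGradient f ξ ω) x₀ t := fun t =>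
    measurable_sclipEF hc.ε_pos hf x₀ t fun s _ => hξ.measurable s
  have hmm : Measurable fun ω =>
      ∑ i, (sclipEF (schedule cφ τ cβ cη) (noisyGradient f ξ ω) x₀ (t + 1)).2 i :=
    Finset.measurable_fun_sum _ fun i _ =>
      (measurable_pi_apply i).comp (measurable_snd.comp (hmeas (t + 1)))
  have hint : Integrable (fun ω =>
      inner ℝ ((sclipEF (schedule cφ τ cβ cη) (noisyGradient f ξ ω) x₀ t).1 - xstar)
        (∑ i, (sclipEF (schedule cφ τ cβ cη) (noisyGradient f ξ ω) x₀ (t + 1)).2 i)) P := by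
    obtain ⟨R, -, hR⟩ := hc.exists_norm_sub_le (n := n) x₀ xstar
    refine Integrable.of_bound (C := (R + 10 / 3 * (√d * cη * cφ) * ((t : ℝ) + 1) ^ (3 / 10 : ℝ))
      * ∑ _i : Fin n, √d * cφ)
      (((measurable_fst.comp (hmeas t)).sub_const xstar).inner hmm).aestronglyMeasurable
      (ae_of_all _ fun ω => ?_)
    refine (norm_inner_le_norm _ _).trans (mul_le_mul (hR _ t) ?_ (norm_nonneg _)
      ((norm_nonneg _).trans (hR (noisyGradient f ξ ω) t)))
    exact norm_sum_le_of_le _ fun i _ =>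
      EuclideanSpace.norm_le_sqrt_mul hφ.le (hc.abs_estimator_le _ x₀ (t + 1) i)
  obtain ⟨hdint, hdrift⟩ :=
    hξ.integral_inner_eq_integral_meanDrift hc.ε_pos hf x₀ xstar t hint
  refine ⟨hdint, ?_⟩
  have hstep : ∀ ω,
      ‖(sclipEF (schedule cφ τ cβ cη) (noisyGradient f ξ ω) x₀ (t + 1)).1 - xstar‖ ^ 2
      ≤ ‖(sclipEF (schedule cφ τ cβ cη) (noisyGradient f ξ ω) x₀ t).1 - xstar‖ ^ 2
        - 2 * ((schedule cφ τ cβ cη).η t / n)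
          * inner ℝ ((sclipEF (schedule cφ τ cβ cη) (noisyGradient f ξ ω) x₀ t).1 - xstar)
            (∑ i, (sclipEF (schedule cφ τ cβ cη) (noisyGradient f ξ ω) x₀ (t + 1)).2 i)
        + 25 * (√d * cη * cφ) ^ 2 * ((t : ℝ) + 1) ^ (-(7 / 5) : ℝ) := fun ω => by
    have h1 := hc.norm_step_le (noisyGradient f ξ ω) x₀ t
    have h2 : ((t : ℝ) + 1) ^ (-(6 / 5) : ℝ) ≤ ((t : ℝ) + 1) ^ (-(7 / 10) : ℝ) :=
      Real.rpow_le_rpow_of_exponent_le (by linarith [t.cast_nonneg (α := ℝ)]) (by norm_num)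
    have h3 := pow_le_pow_left₀ (norm_nonneg _) (h1.trans (c := 5 * (√d * cη * cφ)
      * ((t : ℝ) + 1) ^ (-(7 / 10) : ℝ)) (by
        have := mul_le_mul_of_nonneg_left h2 (show 0 ≤ √d * cη * cφ by positivity)
        linarith)) 2
    have e4 : (((t : ℝ) + 1) ^ (-(7 / 10) : ℝ)) ^ 2 = ((t : ℝ) + 1) ^ (-(7 / 5) : ℝ) := by
      rw [← Real.rpow_natCast, ← Real.rpow_mul hT.le]; norm_num
    rw [mul_pow, mul_pow, e4] at h3
    have h5 : (sclipEF (schedule cφ τ cβ cη) (noisyGradient f ξ ω) x₀ (t + 1)).1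
        - (sclipEF (schedule cφ τ cβ cη) (noisyGradient f ξ ω) x₀ t).1
        = -(((schedule cφ τ cβ cη).η t / (n : ℝ))
          • ∑ i, (sclipEF (schedule cφ τ cβ cη) (noisyGradient f ξ ω) x₀ (t + 1)).2 i) := by
      simp [sclipEF]
    have h6 : (sclipEF (schedule cφ τ cβ cη) (noisyGradient f ξ ω) x₀ (t + 1)).1 - xstar
        = ((sclipEF (schedule cφ τ cβ cη) (noisyGradient f ξ ω) x₀ t).1 - xstar)
          + ((sclipEF (schedule cφ τ cβ cη) (noisyGradient f ξ ω) x₀ (t + 1)).1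
            - (sclipEF (schedule cφ τ cβ cη) (noisyGradient f ξ ω) x₀ t).1) := by abel
    rw [h6, norm_add_sq_real]
    nth_rw 1 [h5]
    rw [inner_neg_right, inner_smul_right]
    linarith
  have i0 := integrable_norm_sub_sq hc hf hξ x₀ xstar t
  have i1 := hint.const_mul (2 * ((schedule cφ τ cβ cη).η t / n))
  calc _ ≤ ∫ ω, (‖(sclipEF (schedule cφ τ cβ cη) (noisyGradient f ξ ω) x₀ t).1 - xstar‖ ^ 2
        - 2 * ((schedule cφ τ cβ cη).η t / n)
          * inner ℝ ((sclipEF (schedule cφ τ cβ cη) (noisyGradient f ξ ω) x₀ t).1 - xstar)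
            (∑ i, (sclipEF (schedule cφ τ cβ cη) (noisyGradient f ξ ω) x₀ (t + 1)).2 i)
        + 25 * (√d * cη * cφ) ^ 2 * ((t : ℝ) + 1) ^ (-(7 / 5) : ℝ)) ∂P :=
        integral_mono (integrable_norm_sub_sq hc hf hξ x₀ xstar (t + 1))
          ((i0.sub i1).add (integrable_const _)) hstep
    _ = _ := by
        rw [integral_add (by exact i0.sub i1) (integrable_const _), integral_sub i0 i1,
          integral_const_mul, hdrift]
        simp

theorem tendsto_rpow_mul_integral_norm_sub_sq {μ L σ cstar : ℝ} {xstar : Vec d}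
    (hp : SymmetricDensity σ p) (hξ : GradientNoise P p ξ)
    (hc : ScheduleConstants cφ τ cβ cη) (hn : 0 < n) (hd : 0 < d) (hσ : 0 ≤ σ)
    (hμ : 0 < μ) (hμL : μ ≤ L) (hf : ∀ i, HessianBounds μ L (f i))
    (hsum : ∑ i, gradient (f i) xstar = 0)
    (hcstar : ∀ i k, |gradient (f i) xstar k| ≤ cstar) {ρ₀ : ℝ}
    (hρ₀ : 110 / 9 * (cη ^ 2 * cφ ^ 2 * d * L ^ 2 / τ) ≤ ρ₀)
    (hρκ : 110 / 9 * (cη ^ 2 * cφ ^ 2 * d * L ^ 2 / τ) * √(L / μ - 1) ≤ 1 / 10) (x₀ : Vec d)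
    {δ : ℝ} (hδ : 0 < δ) (hδc : δ < contractionRate μ cφ τ cη ρ₀) (hδ2 : δ < 2 / 5) :
    Tendsto (fun t : ℕ => ((t : ℝ) + 1) ^ δ *
      ∫ ω, ‖(sclipEF (schedule cφ τ cβ cη) (noisyGradient f ξ ω) x₀ t).1 - xstar‖ ^ 2 ∂P)
      atTop (𝓝 0) := by
  have hgrad : ∀ i, Continuous (gradient (f i)) := fun i => (hf i).continuous_gradient
  have hcs : 0 ≤ cstar := (abs_nonneg _).trans (hcstar ⟨0, hn⟩ ⟨0, hd⟩)
  have hprob : IsProbabilityMeasure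
      ((volume : Measure ℝ).withDensity fun u => ENNReal.ofReal (p u)) := by
    rw [← hξ.density 0 ⟨0, hn⟩ ⟨0, hd⟩]
    refine Measure.isProbabilityMeasure_map (Measurable.aemeasurable ?_)
    exact (by fun_prop : Continuous fun x : Vec d => x ⟨0, hd⟩).measurable.comp
      ((measurable_pi_apply _).comp (hξ.measurable 0))
  obtain ⟨C, hC⟩ := hc.eventually_norm_sq_sub_meanDrift_le hp.isSymmetricNoise hn hd hσ hμ hμL hf
    hsum hcs hcstar hρ₀ hρκ x₀
  refine tendsto_rpow_mul_of_recursion (C := C + 25 * (√d * cη * cφ) ^ 2)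
    (fun t => integral_nonneg fun ω => by positivity) hδ hδc hδ2 ?_
  filter_upwards [hC] with t ht
  obtain ⟨i2, hle⟩ := integral_norm_sub_sq_succ_le hc hgrad hξ x₀ xstar t
  have i0 := integrable_norm_sub_sq hc hgrad hξ x₀ xstar t
  have i3 := i2.const_mul (2 * ((schedule cφ τ cβ cη).η t / n))
  have h := integral_mono (i0.sub i3) ((i0.const_mul (1 - contractionRate μ cφ τ cη ρ₀
    / ((t : ℝ) + 1))).add (integrable_const (C * ((t : ℝ) + 1) ^ (-(7 / 5) : ℝ))))
    fun ω => ht (noisyGradient f ξ ω)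
  rw [integral_sub' i0 i3, integral_add' (i0.const_mul _) (integrable_const _),
    integral_const_mul, integral_const_mul, integral_const, probReal_univ, one_smul] at h
  linarith

end MeanSquare

/-! ### The constants of the schedule -/

section Constants

variable {a₁ a₂ b₁ b₂ d μ L σ cφ τ cη : ℝ}

theorem squared_growth_ratio_le (hb₁ : 0 < b₁) (ha₂ : 0 < a₂) (hd : 0 < d) (hμ : 0 < μ)
    (hμL : μ ≤ L) (hσ : 0 < σ) (hη : cη ^ 2 * cφ ^ 2 ≤ a₂ * (σ ^ 2 / μ ^ 2))
    (hτ : b₁ * (d * σ ^ 2 * (L / μ) ^ (5 / 2 : ℝ)) ≤ τ) :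
    110 / 9 * (cη ^ 2 * cφ ^ 2 * d * L ^ 2 / τ) ≤ 110 / 9 * (a₂ / b₁) := by
  have hκ : 1 ≤ L / μ := (one_le_div hμ).2 hμL
  have h1 : (L / μ) ^ 2 ≤ (L / μ) ^ (5 / 2 : ℝ) := by
    rw [← Real.rpow_natCast]
    exact Real.rpow_le_rpow_of_exponent_le hκ (by norm_num)
  have hτ2 : b₁ * (d * σ ^ 2 * (L / μ) ^ 2) ≤ τ := le_trans (by gcongr) hτ
  have hL : 0 < L := hμ.trans_le hμL
  have hτ0 : 0 < τ := lt_of_lt_of_le (by positivity) hτ2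
  refine mul_le_mul_of_nonneg_left ?_ (by norm_num)
  rw [div_le_div_iff₀ hτ0 hb₁]
  calc cη ^ 2 * cφ ^ 2 * d * L ^ 2 * b₁ ≤ a₂ * (σ ^ 2 / μ ^ 2) * d * L ^ 2 * b₁ := by gcongr
    _ = a₂ * (b₁ * (d * σ ^ 2 * (L / μ) ^ 2)) := by field_simp
    _ ≤ a₂ * τ := by gcongr

/-- The compatibility condition on `τ` has enough room for the margin in `110 / 9`, since
`110 / 9 ≤ 98 √2 / 10`. -/
theorem squared_growth_ratio_mul_sqrt_le (hτ0 : 0 < τ)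
    (h : 98 * √(2 * (L / μ - 1)) * (cη ^ 2 * cφ ^ 2) * d * L ^ 2 ≤ τ) (hd : 0 ≤ d) :
    110 / 9 * (cη ^ 2 * cφ ^ 2 * d * L ^ 2 / τ) * √(L / μ - 1) ≤ 1 / 10 := by
  rw [Real.sqrt_mul (by norm_num)] at h
  have h2 : (7 / 5 : ℝ) ≤ √2 := Real.le_sqrt_of_sq_le (by norm_num)
  have h3 : 0 ≤ cη ^ 2 * cφ ^ 2 * d * L ^ 2 * √(L / μ - 1) := by positivity
  have h4 := mul_le_mul_of_nonneg_right h2 h3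
  have h5 : 110 / 9 * (cη ^ 2 * cφ ^ 2 * d * L ^ 2 / τ) * √(L / μ - 1)
      = 110 / 9 * (cη ^ 2 * cφ ^ 2 * d * L ^ 2 * √(L / μ - 1)) / τ := by ring
  rw [h5, div_le_iff₀ hτ0]
  linarith

theorem le_contractionRate (ha₁ : 0 < a₁) (hb₂ : 0 < b₂) (hd : 0 < d) (hμ : 0 < μ) (hL : 0 < L)
    (hσ : 0 < σ) (hcφ : 0 < cφ) (hcη : 0 < cη) (hτ0 : 0 < τ)
    (hη : a₁ * (σ ^ 2 / μ ^ 2) ≤ cη ^ 2 * cφ ^ 2)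
    (hτ : τ ≤ b₂ * (d * σ ^ 2 * (L / μ) ^ (5 / 2 : ℝ))) {ρ₀ : ℝ} :
    1 / (2 * √(1 + ρ₀)) * √(a₁ / b₂) * (d ^ (-(1 / 2) : ℝ) * (L / μ) ^ (-(5 / 4) : ℝ))
      ≤ contractionRate μ cφ τ cη ρ₀ := by
  have hκ : 0 < L / μ := by positivity
  have key : √(a₁ / b₂) * (d ^ (-(1 / 2) : ℝ) * (L / μ) ^ (-(5 / 4) : ℝ)) ≤ cη * cφ / √τ * μ := by
    refine le_of_sq_le_sq ?_ (by positivity)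
    have e1 : (d ^ (-(1 / 2) : ℝ)) ^ 2 = d⁻¹ := by
      rw [← Real.rpow_natCast, ← Real.rpow_mul hd.le, ← Real.rpow_neg_one]; norm_num
    have e2 : ((L / μ) ^ (-(5 / 4) : ℝ)) ^ 2 = ((L / μ) ^ (5 / 2 : ℝ))⁻¹ := by
      rw [← Real.rpow_natCast, ← Real.rpow_mul hκ.le, ← Real.rpow_neg hκ.le]; norm_num
    rw [mul_pow, mul_pow, e1, e2, Real.sq_sqrt (by positivity), mul_pow, div_pow, mul_pow,
      Real.sq_sqrt hτ0.le]
    have hK : 0 < (L / μ) ^ (5 / 2 : ℝ) := by positivity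
    set K := (L / μ) ^ (5 / 2 : ℝ)
    calc a₁ / b₂ * (d⁻¹ * K⁻¹) = a₁ * (σ ^ 2 / μ ^ 2) / (b₂ * (d * σ ^ 2 * K)) * μ ^ 2 := by
          field_simp
      _ ≤ cη ^ 2 * cφ ^ 2 / τ * μ ^ 2 := by gcongr
  have := mul_le_mul_of_nonneg_left key (show 0 ≤ 1 / (2 * √(1 + ρ₀)) by positivity)
  rw [contractionRate]
  linarith

end Constants

theorem corollary1 :
    -- With `W = (1/n) 𝟏 𝟏ᵀ` and a common initial point, the network algorithm is the
    -- server-client algorithm.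
    (∀ (n d : ℕ) (θ : ClipParams) (g : ℕ → Fin n → Vec d → Vec d) (x₀ : Vec d) (t : ℕ)
        (i : Fin n),
      (sclipEFNetwork (averagingMatrix n) θ g (fun _ => x₀) t).1 i = (sclipEF θ g x₀ t).1 ∧
      (sclipEFNetwork (averagingMatrix n) θ g (fun _ => x₀) t).2 i = (sclipEF θ g x₀ t).2 i) ∧
    -- Convergence rate; `a₁, a₂` and `b₁, b₂` are the constants hidden in the two `Θ(⋅)`, and
    -- `c₀` is the one hidden in `Ω(⋅)`.
    (∀ a₁ a₂ b₁ b₂ : ℝ, 0 < a₁ → a₁ ≤ a₂ → 0 < b₁ → b₁ ≤ b₂ →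
      ∃ c₀ : ℝ, 0 < c₀ ∧
        ∀ (d : ℕ) (μ L σ cφ τ cβ cη : ℝ),
          0 < d → 0 < μ → μ ≤ L → 0 < σ → 0 < cφ → 0 < cη → 0 ≤ cβ → cβ < 1 →
          a₁ * (σ ^ 2 / μ ^ 2) ≤ cη ^ 2 * cφ ^ 2 →
          cη ^ 2 * cφ ^ 2 ≤ a₂ * (σ ^ 2 / μ ^ 2) →
          b₁ * (d * σ ^ 2 * (L / μ) ^ (5 / 2 : ℝ)) ≤ τ →
          τ ≤ b₂ * (d * σ ^ 2 * (L / μ) ^ (5 / 2 : ℝ)) →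
          98 * √(2 * (L / μ - 1)) * (cη ^ 2 * cφ ^ 2) * d * L ^ 2 ≤ τ →
          ∃ c_s : ℝ, c₀ * ((d : ℝ) ^ (-(1 / 2) : ℝ) * (L / μ) ^ (-(5 / 4) : ℝ)) ≤ c_s ∧
            ∀ (n : ℕ), 0 < n →
            ∀ (f : Fin n → Vec d → ℝ), (∀ i, HessianBounds μ L (f i)) →
            ∀ (xstar : Vec d), (∀ x, (1 / (n : ℝ)) * ∑ i, f i xstar ≤ (1 / (n : ℝ)) * ∑ i, f i x) →
            ∀ (cstar : ℝ), (∀ i k, |gradient (f i) xstar k| ≤ cstar) →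
            ∀ (p : ℝ → ℝ), SymmetricDensity σ p →
            ∀ (Ω : Type*) [MeasurableSpace Ω] (P : Measure Ω) [IsProbabilityMeasure P]
              (ξ : ℕ → Ω → Fin n → Vec d), GradientNoise P p ξ →
            ∀ (x₀ : Vec d),
              (∀ t : ℕ, Integrable (fun ω =>
                ‖(sclipEF (schedule cφ τ cβ cη) (noisyGradient f ξ ω) x₀ t).1 - xstar‖ ^ 2) P) ∧
              ∀ δ : ℝ, 0 < δ → δ < min c_s (2 / 5) →
                Tendsto (fun t : ℕ => ((t : ℝ) + 1) ^ δ *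
                  ∫ ω, ‖(sclipEF (schedule cφ τ cβ cη) (noisyGradient f ξ ω) x₀ t).1 - xstar‖ ^ 2 ∂P)
                  atTop (𝓝 0)) := by
  refine ⟨fun n d θ g x₀ t i => sclipEFNetwork_averagingMatrix θ g x₀ t i, ?_⟩
  intro a₁ a₂ b₁ b₂ ha₁ ha hb₁ hb
  have ha₂ : 0 < a₂ := ha₁.trans_le ha
  have hb₂ : 0 < b₂ := hb₁.trans_le hb
  refine ⟨1 / (2 * √(1 + 110 / 9 * (a₂ / b₁))) * √(a₁ / b₂), by positivity, ?_⟩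
  intro d μ L σ cφ τ cβ cη hd hμ hμL hσ hcφ hcη hcβ hcβ1 hη₁ hη₂ hτ₁ hτ₂ hcompat
  have hd' : (0 : ℝ) < d := by exact_mod_cast hd
  have hL : 0 < L := hμ.trans_le hμL
  have hτ0 : 0 < τ := lt_of_lt_of_le (by positivity) hτ₁
  have hc : ScheduleConstants cφ τ cβ cη := ⟨hcφ, hτ0, hcβ, hcβ1, hcη⟩
  refine ⟨contractionRate μ cφ τ cη (110 / 9 * (a₂ / b₁)),
    le_contractionRate ha₁ hb₂ hd' hμ hL hσ hcφ hcη hτ0 hη₁ hτ₂, ?_⟩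
  intro n hn f hf xstar hmin cstar hcstar p hp Ω _ P _ ξ hξ x₀
  refine ⟨integrable_norm_sub_sq hc (fun i => (hf i).continuous_gradient) hξ x₀ xstar,
    fun δ hδ hδlt => ?_⟩
  obtain ⟨hδc, hδ2⟩ := lt_min_iff.1 hδlt
  exact tendsto_rpow_mul_integral_norm_sub_sq hp hξ hc hn hd hσ.le hμ hμL hf
    (sum_gradient_eq_zero_of_isMin (fun i => (hf i).contDiff.differentiable (by norm_num)) hmin)
    hcstar (squared_growth_ratio_le hb₁ ha₂ hd' hμ hμL hσ hη₂ hτ₁)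
    (squared_growth_ratio_mul_sqrt_le hτ0 hcompat hd'.le) x₀ hδ hδc hδ2
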